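/- **Setting.** Let $(\bar M,g)$ be a smooth Riemannian manifold of dimension $2n+1$ with Levi-Civita connection $\bar\nabla$ and an almost contact metric structure $(\phi,\xi,\eta,g)$, i.e. $\phi$ is a smooth $(1,1)$-tensor, $\xi$ a smooth vector field and $\eta$ a smooth $1$-form with $\phi^2X=-X+\eta(X)\xi$, $\phi\xi=0$, $\eta(\xi)=1$, $g(X,\xi)=\eta(X)$, $\eta(\phi X)=0$, $g(\phi X,\phi Y)=g(X,Y)-\eta(X)\eta(Y)$, $g(\phi X,Y)=-g(X,\phi Y)$. Put $\Phi(X,Y)=g(X,\phi Y)$. Assume that $\bar M$ is *SQ-Sasakian* (special quasi-Sasakian) with structure function $\beta$: $\beta$ is a smooth function on $\bar M$ with $\xi\beta=0$, $d\Phi=0$, $\bar\nabla_X\xi=-\beta\phi X$ for all $X$, and $(\phi,\xi,\eta)$ is normal, i.e. $[\phi X,\phi Y]+\phi^2[X,Y]-\phi[\phi X,Y]-\phi[X,\phi Y]+2d\eta(X,Y)\xi=0$ for all $X,Y$, where $2d\eta(X,Y)=X\eta(Y)-Y\eta(X)-\eta([X,Y])$. Let $\widetilde{\bar\nabla}$ be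 the semisymmetric metric connection of $\bar M$: the linear connection with $\widetilde{\bar\nabla}g=0$ and torsion $\tau(X,Y)=\eta(Y)X-\eta(X)Y$. Let $M$ be an (immersed) invariant submanifold of $\bar M$ of dimension $2m+1$, $m<n$: $\xi$ is tangent to $M$ and $\phi(T_xM)\subset T_xM$ for all $x\in M$. The second fundamental form $h(X,Y)$ of $M$ is the normal component of $\bar\nabla_XY$, $H$ is the mean curvature vector (the trace of $h$ divided by $\dim M$), and $M$ is *totally geodesic* if $h=0$. Let $\widetilde\nabla_XY$ and $\widetilde h(X,Y)$ be the tangential and the normal component of $\widetilde{\bar\nabla}_XY$, and let $\widetilde\nabla^\perp_XV$ be the normal component of $\widetilde{\bar\nabla}_XV$, for $X,Y$ tangent and $V$ normal to $M$. Let $\widetilde R$, $\widetilde R^\perp$ be the curvatures of $\widetilde\nabla$, $\widetilde\nabla^\perp$, where the curvature of a connection $\nabla$ is $R(X,Y)=\nabla_X\nabla_Y-\nabla_Y\nabla_X-\nabla_{[X,Y]}$. Put $$(\widetilde{\bar R}(X,Y)\cdot\widetilde h)(Z,U)=\widetilde R^\perp(X,Y)\widetilde h(Z,U)-\widetilde h(\widetilde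 R(X,Y)Z,U)-\widetilde h(Z,\widetilde R(X,Y)U),$$ $$Q(g,\widetilde h)(Z,U;X,Y)=g(Y,Z)\widetilde h(X,U)-g(X,Z)\widetilde h(Y,U)+g(Y,U)\widetilde h(X,Z)-g(X,U)\widetilde h(Y,Z).$$ Let $W=\{x\in M:(h-Hg)_x\neq0\}$. The submanifold $M$ is *Deszcz-pseudo parallel with respect to $\widetilde{\bar\nabla}$ with function $L_h:W\to\mathbb R$* if $(\widetilde{\bar R}(X,Y)\cdot\widetilde h)(Z,U)=L_h\,Q(g,\widetilde h)(Z,U;X,Y)$ holds at all points of $W$ for all vector fields $X,Y,Z,U$ tangent to $M$. **Theorem.** (a) Let $L_h:W\to\mathbb R$ be a function with $(L_h+\beta^2)^2+\beta^2\neq0$ at every point of $W$. Then $M$ is totally geodesic if and only if $M$ is Deszcz-pseudo parallel with respect to $\widetilde{\bar\nabla}$ with function $L_h$. (b) $M$ is totally geodesic if and only if there is a function $L_h:W\to\mathbb R$ with $(L_h+\beta^2)^2+\beta^2\neq0$ at every point of $W$ such that $M$ is Deszcz-pseudo parallel with respect to $\widetilde{\bar\nabla}$ with function $L_h$. -/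

import Mathlib

open Bundle
open scoped Manifold ContDiff

noncomputable section

namespace SQSasakian

/-- The model space of `d`-dimensional manifolds. -/
abbrev Model (d : ℕ) : Type := EuclideanSpace ℝ (Fin d)

section Ambient

variable {d : ℕ} {N : Type*} [TopologicalSpace N] [ChartedSpace (Model d) N]

/-- `X` is a smooth (i.e. `C^∞`) vector field on `N`. -/
def IsSmoothField [IsManifold (𝓡 d) ∞ N] (X : Π y : N, TangentSpace (𝓡 d) y) : Prop :=
  ContMDiff (𝓡 d) (𝓡 d).tangent ∞ (fun y ↦ (⟨y, X y⟩ : TangentBundle (𝓡 d) N))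

/-- The Lie bracket `[X, Y]` of vector fields. -/
abbrev bracket (X Y : Π y : N, TangentSpace (𝓡 d) y) : Π y : N, TangentSpace (𝓡 d) y :=
  VectorField.mlieBracket (𝓡 d) X Y

/-- The derivative `X u` of the function `u` along the vector field `X`. -/
def dirDeriv (X : Π y : N, TangentSpace (𝓡 d) y) (u : N → ℝ) : N → ℝ :=
  fun y ↦ mvfderiv (𝓡 d) u y (X y)

variable [IsManifold (𝓡 d) ∞ N] [RiemannianBundle (fun y : N ↦ TangentSpace (𝓡 d) y)]

/-- The Riemannian metric `g` of the manifold. -/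
def metric {y : N} (u v : TangentSpace (𝓡 d) y) : ℝ := inner ℝ u v

variable (d N) in
/-- An almost contact metric structure `(φ, ξ, η, g)` on `N`, where `g` is the given Riemannian
metric of `N`. -/
structure AlmostContactMetric where
  /-- the structure tensor of type `(1,1)` -/
  φ : Π y : N, TangentSpace (𝓡 d) y →L[ℝ] TangentSpace (𝓡 d) y
  /-- the structure vector field -/
  ξ : Π y : N, TangentSpace (𝓡 d) y
  /-- the structure 1-form -/
  η : Π y : N, TangentSpace (𝓡 d) y →L[ℝ] ℝ
  smooth_φ : ∀ X, IsSmoothField X → IsSmoothField (fun y ↦ φ y (X y))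
  smooth_ξ : IsSmoothField ξ
  smooth_η : ∀ X, IsSmoothField X → ContMDiff (𝓡 d) 𝓘(ℝ, ℝ) ∞ (fun y ↦ η y (X y))
  φ_φ : ∀ y (u : TangentSpace (𝓡 d) y), φ y (φ y u) = -u + η y u • ξ y
  φ_ξ : ∀ y, φ y (ξ y) = 0
  η_ξ : ∀ y, η y (ξ y) = 1
  metric_ξ : ∀ y (u : TangentSpace (𝓡 d) y), metric u (ξ y) = η y u
  η_φ : ∀ y (u : TangentSpace (𝓡 d) y), η y (φ y u) = 0
  metric_φ_φ : ∀ y (u v : TangentSpace (𝓡 d) y),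
    metric (φ y u) (φ y v) = metric u v - η y u * η y v
  metric_φ : ∀ y (u v : TangentSpace (𝓡 d) y), metric (φ y u) v = -metric u (φ y v)

namespace AlmostContactMetric

variable (S : AlmostContactMetric d N)

/-- The vector field `φ X`. -/
def φField (X : Π y : N, TangentSpace (𝓡 d) y) : Π y : N, TangentSpace (𝓡 d) y :=
  fun y ↦ S.φ y (X y)

/-- The function `η(X)`. -/
def ηFun (X : Π y : N, TangentSpace (𝓡 d) y) : N → ℝ := fun y ↦ S.η y (X y)

/-- The fundamental 2-form `Φ(X, Y) = g(X, φ Y)`. -/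
def Φ (X Y : Π y : N, TangentSpace (𝓡 d) y) : N → ℝ := fun y ↦ metric (X y) (S.φ y (Y y))

/-- `2 dη(X, Y) = X(η(Y)) - Y(η(X)) - η([X, Y])`; this is the normalization of the exterior
derivative that is customary in contact geometry. -/
def twoDη (X Y : Π y : N, TangentSpace (𝓡 d) y) : N → ℝ := fun y ↦
  dirDeriv X (S.ηFun Y) y - dirDeriv Y (S.ηFun X) y - S.ηFun (bracket X Y) y

/-- `3 dΦ(X, Y, Z)`, by the invariant formula for the exterior derivative. -/
def threeDΦ (X Y Z : Π y : N, TangentSpace (𝓡 d) y) : N → ℝ := fun y ↦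
  dirDeriv X (S.Φ Y Z) y + dirDeriv Y (S.Φ Z X) y + dirDeriv Z (S.Φ X Y) y
    - S.Φ (bracket X Y) Z y - S.Φ (bracket Y Z) X y - S.Φ (bracket Z X) Y y

/-- The tensor
`N(X, Y) = [φX, φY] + φ²[X, Y] - φ[φX, Y] - φ[X, φY] + 2 dη(X, Y) ξ`. -/
def nijenhuis (X Y : Π y : N, TangentSpace (𝓡 d) y) : Π y : N, TangentSpace (𝓡 d) y := fun y ↦
  bracket (S.φField X) (S.φField Y) y + S.φ y (S.φ y (bracket X Y y))
    - S.φ y (bracket (S.φField X) Y y) - S.φ y (bracket X (S.φField Y) y)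
    + S.twoDη X Y y • S.ξ y

/-- The almost contact structure `(φ, ξ, η)` is normal. -/
def IsNormal : Prop :=
  ∀ X Y, IsSmoothField X → IsSmoothField Y → ∀ y, S.nijenhuis X Y y = 0

/-- `dΦ = 0`. -/
def IsClosedΦ : Prop :=
  ∀ X Y Z, IsSmoothField X → IsSmoothField Y → IsSmoothField Z → ∀ y, S.threeDΦ X Y Z y = 0

end AlmostContactMetric

section Connections

variable [IsContMDiffRiemannianBundle (𝓡 d) ∞ (Model d) (fun y : N ↦ TangentSpace (𝓡 d) y)]

/-- The `C^∞` metric is in particular of class `C^1`. -/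
instance isContMDiffRiemannianBundle_one :
    IsContMDiffRiemannianBundle (𝓡 d) 1 (Model d) (fun y : N ↦ TangentSpace (𝓡 d) y) :=
  IsContMDiffRiemannianBundle.of_le (n := ∞) (by norm_num)

variable (d N) in
/-- A linear connection on `N`. The value `D Y y u` is `D_u Y` at the point `y`. -/
abbrev Connection : Type _ :=
  CovariantDerivative (𝓡 d) (Model d) (TangentSpace (𝓡 d) : N → Type _)

/-- `D` is the Levi-Civita connection of the metric: torsion-free and metric. -/
structure IsLeviCivita (D : Connection d N) : Prop where
  torsion_eq_zero : D.torsion = 0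
  metric : D.IsMetricCompatible

/-- `D` is the semisymmetric metric connection with associated 1-form `η`: it is metric and its
torsion is `τ(X, Y) = η(Y) X - η(X) Y`. -/
structure IsSemisymmetricMetric (η : Π y : N, TangentSpace (𝓡 d) y →L[ℝ] ℝ)
    (D : Connection d N) : Prop where
  torsion_eq : ∀ y (u v : TangentSpace (𝓡 d) y), D.torsion y u v = η y v • u - η y u • v
  metric : D.IsMetricCompatible

/-- The almost contact metric structure `S` on `N` is special quasi-Sasakian (SQ-Sasakian) with
structure function `β`; here `D` is the Levi-Civita connection of `N`. -/
structure IsSQSasakian (S : AlmostContactMetric d N) (β : N → ℝ) (D : Connection d N) : Prop where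
  smooth_β : ContMDiff (𝓡 d) 𝓘(ℝ, ℝ) ∞ β
  ξ_β : ∀ y, dirDeriv S.ξ β y = 0
  closed : S.IsClosedΦ
  normal : S.IsNormal
  D_ξ : ∀ y (u : TangentSpace (𝓡 d) y), D S.ξ y u = -(β y • S.φ y u)

end Connections

end Ambient

section Submanifold

/-! A submanifold of `N` is given by an immersion `f : M → N`; the tangent space of the submanifold
at `x` is the image of the differential of `f` at `x`. Vector fields along the submanifold are
sections `V` of the pulled back tangent bundle, `V x ∈ T_{f x} N`. -/

variable {k d : ℕ} {M : Type*} [TopologicalSpace M] [ChartedSpace (Model k) M]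
  [IsManifold (𝓡 k) ∞ M]
  {N : Type*} [TopologicalSpace N] [ChartedSpace (Model d) N] [IsManifold (𝓡 d) ∞ N]

variable (k d) in
/-- The differential `df : T_x M → T_{f x} N`. -/
abbrev df (f : M → N) (x : M) : TangentSpace (𝓡 k) x →L[ℝ] TangentSpace (𝓡 d) (f x) :=
  mfderiv (𝓡 k) (𝓡 d) f x

/-- The vector field `df Y` along `f`, for a vector field `Y` on `M`. -/
def pushField (f : M → N) (Y : Π x : M, TangentSpace (𝓡 k) x) :
    Π x : M, TangentSpace (𝓡 d) (f x) := fun x ↦ df k d f x (Y x)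

/-- The covariant derivative `D_v V` of a vector field `V` along `f` in the direction
`v ∈ T_x M`, i.e. the pull-back along `f` of the connection `D` of `N`.
In the local frame `(e_i)` of `TN` given by the preferred trivialization at `f x`, let
`V = ∑ V^i (e_i ∘ f)` near `x`. Then
`D_v V = ∑ dV^i(v) e_i + ∑ V^i(x) D_{df v} e_i`.
The first sum is the derivative of the coordinate expression of `V`; the second one is the
derivative of the local field on `N` with constant coefficients that extends `V x`. -/
def alongDeriv (D : Connection d N) (f : M → N) (V : Π x : M, TangentSpace (𝓡 d) (f x)) (x : M)
    (v : TangentSpace (𝓡 k) x) : TangentSpace (𝓡 d) (f x) :=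
  letI e := trivializationAt (Model d) (TangentSpace (𝓡 d) : N → Type _) (f x)
  e.symm (f x) (mvfderiv (𝓡 k) (fun x' ↦ (e ⟨f x', V x'⟩).2) x v)
    + D (FiberBundle.extend (Model d) (V x)) (f x) (df k d f x v)

variable [RiemannianBundle (fun y : N ↦ TangentSpace (𝓡 d) y)]

variable (d) in
/-- The induced metric on `M`. -/
def inducedMetric (f : M → N) {x : M} (u v : TangentSpace (𝓡 k) x) : ℝ :=
  metric (df k d f x u) (df k d f x v)

variable (k) in
/-- The tangential component of `w ∈ T_{f x} N`, as a vector of `T_x M`: the (unique, when `f` is an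
immersion) vector `u` such that `w - df u` is orthogonal to the submanifold. -/
def tangentPart (f : M → N) (x : M) (w : TangentSpace (𝓡 d) (f x)) : TangentSpace (𝓡 k) x :=
  Classical.epsilon fun u ↦ ∀ v : TangentSpace (𝓡 k) x, metric (w - df k d f x u) (df k d f x v) = 0

variable (k) in
/-- The normal component of `w ∈ T_{f x} N`. -/
def normalPart (f : M → N) (x : M) (w : TangentSpace (𝓡 d) (f x)) : TangentSpace (𝓡 d) (f x) :=
  w - df k d f x (tangentPart k f x w)

/-- The connection induced on `M` by the connection `D` of `N`: `∇_X Y` is the tangential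
component of `D_X Y`. -/
def inducedConn (D : Connection d N) (f : M → N) (X Y : Π x : M, TangentSpace (𝓡 k) x) :
    Π x : M, TangentSpace (𝓡 k) x :=
  fun x ↦ tangentPart k f x (alongDeriv D f (pushField f Y) x (X x))

/-- The normal connection induced by `D`: `∇^⊥_X V` is the normal component of `D_X V`. -/
def normalConn (D : Connection d N) (f : M → N) (X : Π x : M, TangentSpace (𝓡 k) x)
    (V : Π x : M, TangentSpace (𝓡 d) (f x)) : Π x : M, TangentSpace (𝓡 d) (f x) :=
  fun x ↦ normalPart k f x (alongDeriv D f V x (X x))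

/-- The second fundamental form at `x` with respect to the connection `D`: `h(u, v)` is the normal
component of `D_u Y`, where `Y` is a local smooth vector field on `M` with `Y x = v`. -/
def secondFundForm (D : Connection d N) (f : M → N) (x : M) (u v : TangentSpace (𝓡 k) x) :
    TangentSpace (𝓡 d) (f x) :=
  normalPart k f x (alongDeriv D f (pushField f (FiberBundle.extend (Model k) v)) x u)

variable (k) in
/-- The submanifold is totally geodesic: `h = 0` (with `D` the Levi-Civita connection). -/
def IsTotallyGeodesic (D : Connection d N) (f : M → N) : Prop :=
  ∀ (x : M) (u v : TangentSpace (𝓡 k) x), secondFundForm D f x u v = 0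

/-- The `i`-th vector of the standard basis of `T_x M`. -/
def basisVec (x : M) (i : Fin k) : TangentSpace (𝓡 k) x := EuclideanSpace.basisFun (Fin k) ℝ i

variable (k d) in
/-- The Gram matrix `(g_ij)` of the induced metric. -/
def gram (f : M → N) (x : M) : Matrix (Fin k) (Fin k) ℝ :=
  Matrix.of fun i j ↦ inducedMetric d f (basisVec x i) (basisVec x j)

variable (k) in
/-- The mean curvature vector `H = (1 / k) ∑ g^ij h_ij`, where `k` is the dimension of `M` and
`(g^ij)` is the inverse of `(g_ij)`. -/
def meanCurvature (D : Connection d N) (f : M → N) (x : M) : TangentSpace (𝓡 d) (f x) :=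
  (k : ℝ)⁻¹ • ∑ i, ∑ j, (gram k d f x)⁻¹ i j • secondFundForm D f x (basisVec x i) (basisVec x j)

variable (k) in
/-- The set `W = {x ∈ M : (h - H g)_x ≠ 0}`. -/
def nonUmbilicalSet (D : Connection d N) (f : M → N) : Set M :=
  {x | ∃ u v : TangentSpace (𝓡 k) x,
    secondFundForm D f x u v - inducedMetric d f u v • meanCurvature k D f x ≠ 0}

/-- The curvature tensor of the induced connection,
`R(X, Y) Z = ∇_X ∇_Y Z - ∇_Y ∇_X Z - ∇_[X,Y] Z`. -/
def inducedCurv (D : Connection d N) (f : M → N) (X Y Z : Π x : M, TangentSpace (𝓡 k) x) :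
    Π x : M, TangentSpace (𝓡 k) x := fun x ↦
  inducedConn D f X (inducedConn D f Y Z) x - inducedConn D f Y (inducedConn D f X Z) x
    - inducedConn D f (bracket X Y) Z x

/-- The curvature tensor of the normal connection,
`R^⊥(X, Y) V = ∇^⊥_X ∇^⊥_Y V - ∇^⊥_Y ∇^⊥_X V - ∇^⊥_[X,Y] V`. -/
def normalCurv (D : Connection d N) (f : M → N) (X Y : Π x : M, TangentSpace (𝓡 k) x)
    (V : Π x : M, TangentSpace (𝓡 d) (f x)) : Π x : M, TangentSpace (𝓡 d) (f x) := fun x ↦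
  normalConn D f X (normalConn D f Y V) x - normalConn D f Y (normalConn D f X V) x
    - normalConn D f (bracket X Y) V x

/-- The normal-bundle-valued tensor
`(R(X, Y) · h)(Z, U) = R^⊥(X, Y) h(Z, U) - h(R(X, Y) Z, U) - h(Z, R(X, Y) U)`. -/
def curvActionSecondFundForm (D : Connection d N) (f : M → N)
    (X Y Z U : Π x : M, TangentSpace (𝓡 k) x) : Π x : M, TangentSpace (𝓡 d) (f x) := fun x ↦
  normalCurv D f X Y (fun x' ↦ secondFundForm D f x' (Z x') (U x')) x
    - secondFundForm D f x (inducedCurv D f X Y Z x) (U x)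
    - secondFundForm D f x (Z x) (inducedCurv D f X Y U x)

/-- `Q(g, h)(Z, U; X, Y) = g(Y, Z) h(X, U) - g(X, Z) h(Y, U) + g(Y, U) h(X, Z) - g(X, U) h(Y, Z)`. -/
def tachibana (D : Connection d N) (f : M → N) (X Y Z U : Π x : M, TangentSpace (𝓡 k) x) :
    Π x : M, TangentSpace (𝓡 d) (f x) := fun x ↦
  inducedMetric d f (Y x) (Z x) • secondFundForm D f x (X x) (U x)
    - inducedMetric d f (X x) (Z x) • secondFundForm D f x (Y x) (U x)
    + inducedMetric d f (Y x) (U x) • secondFundForm D f x (X x) (Z x)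
    - inducedMetric d f (X x) (U x) • secondFundForm D f x (Y x) (Z x)

variable (k) in
/-- The submanifold is Deszcz-pseudo parallel with respect to the connection `D`, with associated
function `L` on the set `W`: `R(X, Y) · h = L Q(g, h)` on `W`, where `R`, `h` are those of `D`. -/
def IsDeszczPseudoParallel (D : Connection d N) (f : M → N) (W : Set M) (L : W → ℝ) : Prop :=
  ∀ X Y Z U : Π x : M, TangentSpace (𝓡 k) x,
    IsSmoothField X → IsSmoothField Y → IsSmoothField Z → IsSmoothField U →
    ∀ x : W, curvActionSecondFundForm D f X Y Z U x = L x • tachibana D f X Y Z U x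

variable (k) in
/-- The submanifold is invariant: `ξ` is tangent to it and `φ` maps its tangent spaces to
themselves. -/
def IsInvariant (S : AlmostContactMetric d N) (f : M → N) : Prop :=
  ∀ x : M, S.ξ (f x) ∈ Set.range (df k d f x) ∧
    ∀ u : TangentSpace (𝓡 k) x, S.φ (f x) (df k d f x u) ∈ Set.range (df k d f x)

end Submanifold

end SQSasakian

end

/-! Everything rests on testing the pseudo-parallel condition on `(X, ξ; Z, ξ)`. Since `ξ` is
tangent to `M`, passing from the Levi-Civita to the semisymmetric connection changes `∇_X Y` by the
tangential vector `η(Y)X - g(X,Y)ξ`, so both connections have the same second fundamental form `h`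
(`secondFundForm_semisymmetric`). The semisymmetric derivative of `ξ` in the direction `u` is `-βφu
+ u - η(u)ξ`, tangent by invariance, so `h(·, ξ) = 0` (`secondFundForm_ξ`).

Hence `Q(g,h)` reduces to `h(Z,X)`, and the curvature action to `-h(Z, R(X,ξ)ξ)`. Normality makes
`φ` invariant under the flow of `ξ`, hence parallel along `ξ`; together with `ξβ = 0` this gives
`R(X,ξ)ξ = β²X + βφX` modulo `ξ` (`exists_inducedCurv_ξ_ξ`). The condition becomes `(L + β²) h(Z,X)
+ β h(Z,φX) = 0`. Replacing `X` by `φX` gives a second equation, and the determinant of the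
resulting 2×2 system is `(L + β²)² + β²`. So `h = 0` at each point of `W`, which contradicts the
definition of `W`; therefore `W` is empty and `M` is totally umbilical. Then `H = g(ξ,ξ)H = h(ξ,ξ) =
0`, so `h = 0`.

The groundwork shows that `alongDeriv` behaves as a pulled-back connection: Leibniz rule,
compatibility with restriction (`alongDeriv_comp`), torsion (`alongDeriv_pushField_sub`), and
commutation with tensors parallel in the given direction (`alongDeriv_map_of_parallel`). -/

noncomputable section

namespace SQSasakian

open Filter Topology

/-! ### Extension of local vector fields to global smooth ones -/

section GlobalFields

variable {d : ℕ} {N : Type*} [TopologicalSpace N] [ChartedSpace (Model d) N]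
  [IsManifold (𝓡 d) ∞ N]

lemma IsSmoothField.mdifferentiableAt {X : Π y : N, TangentSpace (𝓡 d) y} (hX : IsSmoothField X)
    (y : N) : MDifferentiableAt (𝓡 d) (𝓡 d).tangent
      (fun y ↦ (⟨y, X y⟩ : TangentBundle (𝓡 d) N)) y :=
  (hX y).mdifferentiableAt (by simp)

/-- A field that is smooth on a chart domain agrees near the centre of the chart with a globally
smooth field. -/
lemma exists_isSmoothField_eventuallyEq [T2Space N] (p : N) {X : Π y : N, TangentSpace (𝓡 d) y}
    (hX : ContMDiffOn (𝓡 d) (𝓡 d).tangent ∞ (fun y ↦ (⟨y, X y⟩ : TangentBundle (𝓡 d) N))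
      (chartAt (Model d) p).source) :
    ∃ Y : Π y : N, TangentSpace (𝓡 d) y, IsSmoothField Y ∧ ∀ᶠ y in 𝓝 p, X y = Y y := by
  obtain ⟨b⟩ : Nonempty (SmoothBumpFunction (𝓡 d) p) := inferInstance
  refine ⟨(b : N → ℝ) • X, ?_, ?_⟩
  · exact ContMDiffOn.smul_section_of_tsupport b.contMDiff.contMDiffOn
      (chartAt (Model d) p).open_source b.tsupport_subset_chartAt_source hX
  · filter_upwards [b.eventuallyEq_one] with y hy
    simp [hy]

/-- Pseudo-parallelism is a condition on global smooth fields; pointwise conclusions need every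
tangent vector to be a value of such a field. -/
lemma exists_isSmoothField_eq [T2Space N] (p : N) (v : TangentSpace (𝓡 d) p) :
    ∃ Y : Π y : N, TangentSpace (𝓡 d) y, IsSmoothField Y ∧ Y p = v := by
  have h : ContMDiffOn (𝓡 d) (𝓡 d).tangent ∞
      (fun y ↦ (⟨y, FiberBundle.extend (Model d) v y⟩ : TangentBundle (𝓡 d) N))
      (chartAt (Model d) p).source := by
    set t := trivializationAt (Model d) (TangentSpace (𝓡 d) : N → Type _) p
    intro x hx
    rw [t.contMDiffWithinAt_section _ hx]
    have : ContMDiffOn (𝓡 d) 𝓘(ℝ, Model d) ∞ (fun _ : N ↦ (t ⟨p, v⟩).2) t.baseSet :=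
      contMDiffOn_const
    refine (this.congr (fun y hy ↦ ?_)) x hx
    have := congrArg Prod.snd (t.apply_mk_symm hy (t ⟨p, v⟩).2)
    exact this
  obtain ⟨Y, hY, hYX⟩ := exists_isSmoothField_eventuallyEq p h
  exact ⟨Y, hY, by rw [← hYX.self_of_nhds]; simp⟩

end GlobalFields

/-! ### Fields along a map and the pulled-back connection -/

section Along

variable {k d : ℕ} {M : Type*} [TopologicalSpace M] [ChartedSpace (Model k) M]
  {N : Type*} [TopologicalSpace N] [ChartedSpace (Model d) N] [IsManifold (𝓡 d) ∞ N]
  {f : M → N} {x : M}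

variable (k) in
/-- The vector field `V` along `f` is differentiable at `x`. -/
def DiffAlong (f : M → N) (V : Π x : M, TangentSpace (𝓡 d) (f x)) (x : M) : Prop :=
  MDifferentiableAt (𝓡 k) (𝓡 d).tangent (fun x' ↦ (⟨f x', V x'⟩ : TangentBundle (𝓡 d) N)) x

/-- The coordinate expression of `V` in the preferred trivialization at `f x`. -/
def coordAlong (f : M → N) (x : M) (V : Π x : M, TangentSpace (𝓡 d) (f x)) (x' : M) : Model d :=
  (trivializationAt (Model d) (TangentSpace (𝓡 d) : N → Type _) (f x) ⟨f x', V x'⟩).2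

lemma diffAlong_iff {V : Π x : M, TangentSpace (𝓡 d) (f x)} :
    DiffAlong k f V x ↔ MDifferentiableAt (𝓡 k) (𝓡 d) f x ∧
      MDifferentiableAt (𝓡 k) 𝓘(ℝ, Model d) (coordAlong f x V) x :=
  mdifferentiableAt_totalSpace _ _

lemma eventually_mem_baseSet (hf : MDifferentiableAt (𝓡 k) (𝓡 d) f x) :
    ∀ᶠ x' in 𝓝 x, f x' ∈
      (trivializationAt (Model d) (TangentSpace (𝓡 d) : N → Type _) (f x)).baseSet :=
  hf.continuousAt.eventually
    ((trivializationAt (Model d) (TangentSpace (𝓡 d) : N → Type _) (f x)).open_baseSet.mem_nhds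
      (FiberBundle.mem_baseSet_trivializationAt' _))

lemma coordAlong_eq {V : Π x : M, TangentSpace (𝓡 d) (f x)} {x' : M}
    (h : f x' ∈ (trivializationAt (Model d) (TangentSpace (𝓡 d) : N → Type _) (f x)).baseSet) :
    coordAlong f x V x' =
      (trivializationAt (Model d) (TangentSpace (𝓡 d) : N → Type _) (f x)).continuousLinearMapAt
        ℝ (f x') (V x') := by
  rw [Trivialization.continuousLinearMapAt_apply, Trivialization.coe_linearMapAt_of_mem _ h]
  rfl

lemma coordAlong_add (hf : MDifferentiableAt (𝓡 k) (𝓡 d) f x)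
    (V W : Π x : M, TangentSpace (𝓡 d) (f x)) :
    coordAlong f x (fun x' ↦ V x' + W x') =ᶠ[𝓝 x] coordAlong f x V + coordAlong f x W := by
  filter_upwards [eventually_mem_baseSet hf] with x' h
  simp only [Pi.add_apply, coordAlong_eq h, map_add]

lemma coordAlong_smul (hf : MDifferentiableAt (𝓡 k) (𝓡 d) f x) (c : M → ℝ)
    (V : Π x : M, TangentSpace (𝓡 d) (f x)) :
    coordAlong f x (fun x' ↦ c x' • V x') =ᶠ[𝓝 x] c • coordAlong f x V := by
  filter_upwards [eventually_mem_baseSet hf] with x' h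
  simp only [Pi.smul_apply', coordAlong_eq h, map_smul]

lemma DiffAlong.mdifferentiableAt {V : Π x : M, TangentSpace (𝓡 d) (f x)}
    (h : DiffAlong k f V x) : MDifferentiableAt (𝓡 k) (𝓡 d) f x := (diffAlong_iff.1 h).1

lemma DiffAlong.add {V W : Π x : M, TangentSpace (𝓡 d) (f x)}
    (hV : DiffAlong k f V x) (hW : DiffAlong k f W x) :
    DiffAlong k f (fun x' ↦ V x' + W x') x :=
  diffAlong_iff.2 ⟨hV.mdifferentiableAt, ((diffAlong_iff.1 hV).2.add
    (diffAlong_iff.1 hW).2).congr_of_eventuallyEq (coordAlong_add hV.mdifferentiableAt V W)⟩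

lemma DiffAlong.smul {c : M → ℝ} {V : Π x : M, TangentSpace (𝓡 d) (f x)}
    (hc : MDifferentiableAt (𝓡 k) 𝓘(ℝ, ℝ) c x) (hV : DiffAlong k f V x) :
    DiffAlong k f (fun x' ↦ c x' • V x') x :=
  diffAlong_iff.2 ⟨hV.mdifferentiableAt, (hc.smul
    (diffAlong_iff.1 hV).2).congr_of_eventuallyEq (coordAlong_smul hV.mdifferentiableAt c V)⟩

lemma DiffAlong.congr {V W : Π x : M, TangentSpace (𝓡 d) (f x)}
    (hV : DiffAlong k f V x) (h : ∀ᶠ x' in 𝓝 x, V x' = W x') : DiffAlong k f W x :=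
  MDifferentiableAt.congr_of_eventuallyEq hV (h.mono fun x' hx' ↦ by simp [hx'])

lemma DiffAlong.comp {W : Π y : N, TangentSpace (𝓡 d) y}
    (hf : MDifferentiableAt (𝓡 k) (𝓡 d) f x)
    (hW : MDifferentiableAt (𝓡 d) (𝓡 d).tangent
      (fun y ↦ (⟨y, W y⟩ : TangentBundle (𝓡 d) N)) (f x)) :
    DiffAlong k f (fun x' ↦ W (f x')) x :=
  MDifferentiableAt.comp x hW hf

lemma diffAlong_zero (hf : MDifferentiableAt (𝓡 k) (𝓡 d) f x) :
    DiffAlong k f (fun x' ↦ (0 : TangentSpace (𝓡 d) (f x'))) x :=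
  DiffAlong.comp (W := fun y ↦ (0 : TangentSpace (𝓡 d) y)) hf (mdifferentiableAt_zeroSection ..)

lemma extend_mdifferentiableAt {y : N} (v : TangentSpace (𝓡 d) y) :
    MDifferentiableAt (𝓡 d) (𝓡 d).tangent
      (fun y' ↦ (⟨y', FiberBundle.extend (Model d) v y'⟩ : TangentBundle (𝓡 d) N)) y :=
  FiberBundle.mdifferentiableAt_extend ..

/-- A connection depends only on germs, and near `y` the extension has constant coefficients in the
trivialization at `y`, hence is linear in the vector. -/
lemma connection_extend_add (D : Connection d N) {y : N} (u v : TangentSpace (𝓡 d) y) :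
    D (FiberBundle.extend (Model d) (u + v)) y =
      D (FiberBundle.extend (Model d) u) y + D (FiberBundle.extend (Model d) v) y := by
  rw [← D.isCovariantDerivativeOnUniv.add (extend_mdifferentiableAt u)
    (extend_mdifferentiableAt v)]
  refine D.isCovariantDerivativeOnUniv.congr_of_eventuallyEq (extend_mdifferentiableAt _)
    (mdifferentiableAt_add_section (extend_mdifferentiableAt u) (extend_mdifferentiableAt v))
    univ_mem ?_
  set t := trivializationAt (Model d) (TangentSpace (𝓡 d) : N → Type _) y with ht
  have hy : y ∈ t.baseSet := FiberBundle.mem_baseSet_trivializationAt' _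
  filter_upwards [t.open_baseSet.mem_nhds hy] with y' h
  simp only [FiberBundle.extend, Pi.add_apply, ← ht, ← t.coe_symmₗ (R := ℝ) h, map_add,
    ← congrFun (t.coe_linearMapAt_of_mem (R := ℝ) hy) _]

lemma connection_extend_smul (D : Connection d N) {y : N} (c : ℝ) (v : TangentSpace (𝓡 d) y) :
    D (FiberBundle.extend (Model d) (c • v)) y = c • D (FiberBundle.extend (Model d) v) y := by
  rw [← D.isCovariantDerivativeOnUniv.smul_const c (extend_mdifferentiableAt v)]
  refine D.isCovariantDerivativeOnUniv.congr_of_eventuallyEq (extend_mdifferentiableAt _)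
    (extend_mdifferentiableAt v).smul_const_section univ_mem ?_
  set t := trivializationAt (Model d) (TangentSpace (𝓡 d) : N → Type _) y with ht
  have hy : y ∈ t.baseSet := FiberBundle.mem_baseSet_trivializationAt' _
  filter_upwards [t.open_baseSet.mem_nhds hy] with y' h
  simp only [FiberBundle.extend, Pi.smul_apply, ← ht, ← t.coe_symmₗ (R := ℝ) h, map_smul,
    ← congrFun (t.coe_linearMapAt_of_mem (R := ℝ) hy) _]

/-- The principal part of `alongDeriv`. -/
def alongPrincipal (f : M → N) (V : Π x : M, TangentSpace (𝓡 d) (f x)) (x : M)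
    (v : TangentSpace (𝓡 k) x) : TangentSpace (𝓡 d) (f x) :=
  (trivializationAt (Model d) (TangentSpace (𝓡 d) : N → Type _) (f x)).symmL ℝ (f x)
    (mvfderiv (𝓡 k) (coordAlong f x V) x v)

lemma alongDeriv_eq (D : Connection d N) (V : Π x : M, TangentSpace (𝓡 d) (f x))
    (v : TangentSpace (𝓡 k) x) :
    alongDeriv D f V x v = alongPrincipal f V x v +
      D (FiberBundle.extend (Model d) (V x)) (f x) (df k d f x v) := by
  have hb : f x ∈ (trivializationAt (Model d) (TangentSpace (𝓡 d) : N → Type _) (f x)).baseSet :=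
    FiberBundle.mem_baseSet_trivializationAt' _
  exact congrArg (· + _) (Trivialization.symmL_apply _ hb _).symm

lemma mvfderiv_congr {F : Type*} [NormedAddCommGroup F] [NormedSpace ℝ F] {g g' : M → F}
    (h : g =ᶠ[𝓝 x] g') : mvfderiv (𝓡 k) g x = mvfderiv (𝓡 k) g' x := by
  rw [mvfderiv, mvfderiv, h.mfderiv_eq, h.self_of_nhds]

lemma alongDeriv_congr (D : Connection d N) {V W : Π x : M, TangentSpace (𝓡 d) (f x)}
    (h : ∀ᶠ x' in 𝓝 x, V x' = W x') (v : TangentSpace (𝓡 k) x) :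
    alongDeriv D f V x v = alongDeriv D f W x v := by
  have : coordAlong f x V =ᶠ[𝓝 x] coordAlong f x W := h.mono fun x' hx' ↦ by
    simp [coordAlong, hx']
  rw [alongDeriv_eq, alongDeriv_eq, h.self_of_nhds, alongPrincipal, alongPrincipal,
    mvfderiv_congr this]

lemma alongDeriv_add (D : Connection d N) {V W : Π x : M, TangentSpace (𝓡 d) (f x)}
    (hV : DiffAlong k f V x) (hW : DiffAlong k f W x) (v : TangentSpace (𝓡 k) x) :
    alongDeriv D f (fun x' ↦ V x' + W x') x v = alongDeriv D f V x v + alongDeriv D f W x v := by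
  have h := coordAlong_add hV.mdifferentiableAt V W
  have h' : mvfderiv (𝓡 k) (coordAlong f x fun x' ↦ V x' + W x') x =
      mvfderiv (𝓡 k) (coordAlong f x V) x + mvfderiv (𝓡 k) (coordAlong f x W) x := by
    rw [← mvfderiv_add (diffAlong_iff.1 hV).2 (diffAlong_iff.1 hW).2, mvfderiv_congr h]
  rw [alongDeriv_eq, alongDeriv_eq, alongDeriv_eq, alongPrincipal, h',
    connection_extend_add]
  simp only [alongPrincipal, add_apply, map_add]
  abel

lemma alongDeriv_smul (D : Connection d N) {c : M → ℝ} {V : Π x : M, TangentSpace (𝓡 d) (f x)}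
    (hc : MDifferentiableAt (𝓡 k) 𝓘(ℝ, ℝ) c x)
    (hV : DiffAlong k f V x) (v : TangentSpace (𝓡 k) x) :
    alongDeriv D f (fun x' ↦ c x' • V x') x v =
      c x • alongDeriv D f V x v + mvfderiv (𝓡 k) c x v • V x := by
  have h := coordAlong_smul hV.mdifferentiableAt c V
  have h' : mvfderiv (𝓡 k) (coordAlong f x fun x' ↦ c x' • V x') x =
      c x • mvfderiv (𝓡 k) (coordAlong f x V) x +
        (mvfderiv (𝓡 k) c x).smulRight (coordAlong f x V x) := by
    rw [← mvfderiv_smul hc (diffAlong_iff.1 hV).2, mvfderiv_congr h]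
  have hb : f x ∈ (trivializationAt (Model d) (TangentSpace (𝓡 d) : N → Type _) (f x)).baseSet :=
    FiberBundle.mem_baseSet_trivializationAt' _
  rw [alongDeriv_eq, alongDeriv_eq, alongPrincipal, h', connection_extend_smul]
  simp only [alongPrincipal, add_apply, map_add, map_smul,
    smul_apply, ContinuousLinearMap.smulRight_apply, coordAlong_eq hb,
    Trivialization.symmL_continuousLinearMapAt _ hb]
  module

/-- Along `f`, the derivative of the restriction of a field on `N` is the ambient derivative. -/
lemma alongDeriv_comp (D : Connection d N) {W : Π y : N, TangentSpace (𝓡 d) y}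
    (hf : MDifferentiableAt (𝓡 k) (𝓡 d) f x)
    (hW : MDifferentiableAt (𝓡 d) (𝓡 d).tangent
      (fun y ↦ (⟨y, W y⟩ : TangentBundle (𝓡 d) N)) (f x)) (v : TangentSpace (𝓡 k) x) :
    alongDeriv D f (fun x' ↦ W (f x')) x v = D W (f x) (df k d f x v) := by
  -- By the chain rule the Leibniz terms of the two derivatives cancel. The difference therefore
  -- depends only on `W (f x)`, and can be tested on the constant-coefficient extension, whose
  -- principal part vanishes.
  have key : TensorialAt (𝓡 d) (Model d) (fun W : Π y : N, TangentSpace (𝓡 d) y ↦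
      alongDeriv D f (fun x' ↦ W (f x')) x v - D W (f x) (df k d f x v)) (f x) := by
    constructor
    · intro c σ hc hσ
      have := alongDeriv_smul D (c := fun x' ↦ c (f x')) (hc.comp x hf) (.comp hf hσ) v
      simp only [Pi.smul_apply']
      rw [this, D.isCovariantDerivativeOnUniv.leibniz hσ hc]
      have hcomp : mvfderiv (𝓡 k) (fun x' ↦ c (f x')) x v =
        mvfderiv (𝓡 d) c (f x) (df k d f x v) := mvfderiv_comp_apply x hc hf v
      simp only [hcomp, add_apply, smul_apply,
        ContinuousLinearMap.smulRight_apply]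
      module
    · intro σ σ' hσ hσ'
      simp only [Pi.add_apply]
      rw [alongDeriv_add D (.comp hf hσ) (.comp hf hσ') v,
        D.isCovariantDerivativeOnUniv.add hσ hσ', add_apply]
      abel
  have h0 := key.pointwise hW (extend_mdifferentiableAt (W (f x))) (by simp)
  rw [← sub_eq_zero, h0, alongDeriv_eq]
  have hconst : coordAlong f x (fun x' ↦ FiberBundle.extend (Model d) (W (f x)) (f x')) =ᶠ[𝓝 x]
      fun _ ↦ (trivializationAt (Model d) (TangentSpace (𝓡 d) : N → Type _) (f x)
        ⟨f x, W (f x)⟩).2 := by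
    filter_upwards [eventually_mem_baseSet hf] with x' hx'
    have := congrArg Prod.snd (Trivialization.apply_mk_symm _ hx'
      (trivializationAt (Model d) (TangentSpace (𝓡 d) : N → Type _) (f x) ⟨f x, W (f x)⟩).2)
    exact this
  have : mvfderiv (𝓡 k)
      (coordAlong f x (fun x' ↦ FiberBundle.extend (Model d) (W (f x)) (f x'))) x = 0 := by
    rw [mvfderiv_congr hconst, mvfderiv_const]
  simp [alongPrincipal, this]

end Along

/-! ### Lie brackets as commutators of derivations -/

section Commutator

variable {k : ℕ} {M : Type*} [TopologicalSpace M] [ChartedSpace (Model k) M]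
  [IsManifold (𝓡 k) ∞ M] {F : Type*} [NormedAddCommGroup F] [NormedSpace ℝ F]
  {x : M} {X Y : Π x : M, TangentSpace (𝓡 k) x}

/-- The vector field `X` read in the preferred chart at `x`. -/
def chartField (x : M) (X : Π x : M, TangentSpace (𝓡 k) x) : Model k → Model k :=
  VectorField.mpullbackWithin 𝓘(ℝ, Model k) (𝓡 k) (extChartAt (𝓡 k) x).symm X (Set.range (𝓡 k))

lemma mvfderiv_eq_fderiv_chart {G : M → F} {x' : M} (hx' : x' ∈ (extChartAt (𝓡 k) x).source)
    (hG : MDifferentiableAt (𝓡 k) 𝓘(ℝ, F) G x') (v : TangentSpace (𝓡 k) x') :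
    mvfderiv (𝓡 k) G x' v = fderiv ℝ (G ∘ (extChartAt (𝓡 k) x).symm) (extChartAt (𝓡 k) x x')
      (mfderiv (𝓡 k) 𝓘(ℝ, Model k) (extChartAt (𝓡 k) x) x' v) := by
  have h : G =ᶠ[𝓝 x'] (G ∘ (extChartAt (𝓡 k) x).symm) ∘ extChartAt (𝓡 k) x := by
    filter_upwards [(isOpen_extChartAt_source x).mem_nhds hx'] with z hz
    simp only [Function.comp_apply, PartialEquiv.left_inv _ hz]
  have hφ : MDifferentiableAt (𝓡 k) 𝓘(ℝ, Model k) (extChartAt (𝓡 k) x) x' :=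
    mdifferentiableAt_extChartAt (by simpa using hx')
  have hψ : MDifferentiableAt 𝓘(ℝ, Model k) (𝓡 k) (extChartAt (𝓡 k) x).symm
      (extChartAt (𝓡 k) x x') := by
    have := mdifferentiableWithinAt_extChartAt_symm (I := 𝓡 k) (PartialEquiv.map_source _ hx')
    rwa [ModelWithCorners.range_eq_univ, mdifferentiableWithinAt_univ] at this
  have hG' : MDifferentiableAt 𝓘(ℝ, Model k) 𝓘(ℝ, F) (G ∘ (extChartAt (𝓡 k) x).symm)
      (extChartAt (𝓡 k) x x') := by
    refine MDifferentiableAt.comp _ ?_ hψ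
    rwa [PartialEquiv.left_inv _ hx']
  rw [mvfderiv_congr h]
  have := mfderiv_comp_apply x' hG' hφ v
  rw [mfderiv_eq_fderiv] at this
  exact this

lemma mfderiv_extChartAt_eq_chartField {u : Model k} (hu : u ∈ (extChartAt (𝓡 k) x).target) :
    mfderiv (𝓡 k) 𝓘(ℝ, Model k) (extChartAt (𝓡 k) x) ((extChartAt (𝓡 k) x).symm u)
      (X ((extChartAt (𝓡 k) x).symm u)) = chartField x X u := by
  rw [chartField, VectorField.mpullbackWithin_apply, ContinuousLinearMap.inverse_eq
    (mfderivWithin_extChartAt_symm_comp_mfderiv_extChartAt hu)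
    (mfderiv_extChartAt_comp_mfderivWithin_extChartAt_symm hu)]
  rfl

lemma mvfderiv_field_eq {G : M → F} {x' : M} (hx' : x' ∈ (extChartAt (𝓡 k) x).source)
    (hG : MDifferentiableAt (𝓡 k) 𝓘(ℝ, F) G x') :
    mvfderiv (𝓡 k) G x' (X x') = fderiv ℝ (G ∘ (extChartAt (𝓡 k) x).symm)
      (extChartAt (𝓡 k) x x') (chartField x X (extChartAt (𝓡 k) x x')) := by
  obtain ⟨u, hu, rfl⟩ : ∃ u ∈ (extChartAt (𝓡 k) x).target, (extChartAt (𝓡 k) x).symm u = x' :=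
    ⟨_, PartialEquiv.map_source _ hx', PartialEquiv.left_inv _ hx'⟩
  rw [mvfderiv_eq_fderiv_chart hx' hG, mfderiv_extChartAt_eq_chartField hu,
    PartialEquiv.right_inv _ hu]

lemma differentiableAt_chartField
    (hX : MDifferentiableAt (𝓡 k) (𝓡 k).tangent (fun y ↦ (⟨y, X y⟩ : TangentBundle (𝓡 k) M)) x) :
    DifferentiableAt ℝ (chartField x X) (extChartAt (𝓡 k) x x) := by
  have := MDifferentiableWithinAt.differentiableWithinAt_mpullbackWithin_vectorField (s := Set.univ)
    hX.mdifferentiableWithinAt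
  rw [Set.preimage_univ, Set.univ_inter] at this
  have h : DifferentiableWithinAt ℝ (chartField x X) (Set.range (𝓡 k)) (extChartAt (𝓡 k) x x) :=
    this
  exact h.differentiableAt (by rw [ModelWithCorners.range_eq_univ]; exact univ_mem)

/-- Differentiation along `[X, Y]` is the commutator of the differentiations along `X` and `Y`. -/
lemma mvfderiv_bracket {G : M → F} (hG : ContMDiffAt (𝓡 k) 𝓘(ℝ, F) ∞ G x)
    (hX : MDifferentiableAt (𝓡 k) (𝓡 k).tangent (fun y ↦ (⟨y, X y⟩ : TangentBundle (𝓡 k) M)) x)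
    (hY : MDifferentiableAt (𝓡 k) (𝓡 k).tangent (fun y ↦ (⟨y, Y y⟩ : TangentBundle (𝓡 k) M)) x)
    (hGX : MDifferentiableAt (𝓡 k) 𝓘(ℝ, F) (fun x' ↦ mvfderiv (𝓡 k) G x' (X x')) x)
    (hGY : MDifferentiableAt (𝓡 k) 𝓘(ℝ, F) (fun x' ↦ mvfderiv (𝓡 k) G x' (Y x')) x) :
    mvfderiv (𝓡 k) G x (bracket X Y x) =
      mvfderiv (𝓡 k) (fun x' ↦ mvfderiv (𝓡 k) G x' (Y x')) x (X x) -
        mvfderiv (𝓡 k) (fun x' ↦ mvfderiv (𝓡 k) G x' (X x')) x (Y x) := by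
  have hx := mem_extChartAt_source (I := 𝓡 k) x
  have hcomp : ∀ {Z : Π x : M, TangentSpace (𝓡 k) x},
      (fun x' ↦ mvfderiv (𝓡 k) G x' (Z x')) ∘ (extChartAt (𝓡 k) x).symm
        =ᶠ[𝓝 (extChartAt (𝓡 k) x x)]
      fun u ↦ fderiv ℝ (G ∘ (extChartAt (𝓡 k) x).symm) u (chartField x Z u) := by
    intro Z
    have h1 : ∀ᶠ x' in 𝓝 x, MDifferentiableAt (𝓡 k) 𝓘(ℝ, F) G x' := by
      have := (contMDiffAt_iff_contMDiffAt_nhds (n := 1) (by simp)).1 (hG.of_le (by simp))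
      exact this.mono fun z hz ↦ hz.mdifferentiableAt one_ne_zero
    have h2 := (continuousAt_extChartAt_symm (I := 𝓡 k) x).eventually (by simpa using h1)
    filter_upwards [h2, extChartAt_target_mem_nhds (I := 𝓡 k) x] with u hu hut
    have := mvfderiv_field_eq (X := Z) (PartialEquiv.map_target _ hut) hu
    rw [PartialEquiv.right_inv _ hut] at this
    exact this
  have hG' : ContDiffAt ℝ 2 (G ∘ (extChartAt (𝓡 k) x).symm) (extChartAt (𝓡 k) x x) := by
    have := (contMDiffAt_iff.1 hG).2
    simp only [ModelWithCorners.range_eq_univ, contDiffWithinAt_univ] at this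
    exact ContDiffAt.of_le this (by norm_cast)
  -- In the chart the identity is the symmetry of the second derivative of `G`; what remains is to
  -- match the two brackets.
  rw [mvfderiv_field_eq hx hGX, mvfderiv_field_eq hx hGY, hcomp.fderiv_eq, hcomp.fderiv_eq,
    ← VectorField.fderiv_apply_lieBracket_of_isSymmSndFDerivAt hG'
      (hG'.isSymmSndFDerivAt (by simp)) (differentiableAt_chartField hY)
      (differentiableAt_chartField hX),
    mvfderiv_eq_fderiv_chart hx (hG.mdifferentiableAt (by simp))]
  congr 1
  have hinv := isInvertible_mfderiv_extChartAt (I := 𝓡 k) hx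
  have hset : (extChartAt (𝓡 k) x).symm ⁻¹' Set.univ ∩ Set.range (𝓡 k) = Set.univ := by
    rw [ModelWithCorners.range_eq_univ, Set.preimage_univ, Set.univ_inter]
  have hb : VectorField.lieBracketWithin ℝ (chartField x X) (chartField x Y)
      ((extChartAt (𝓡 k) x).symm ⁻¹' Set.univ ∩ Set.range (𝓡 k)) (extChartAt (𝓡 k) x x) =
      VectorField.lieBracket ℝ (chartField x X) (chartField x Y) (extChartAt (𝓡 k) x x) := by
    rw [hset, VectorField.lieBracketWithin_univ]
  exact (hinv.inverse_apply_eq.1 rfl).symm.trans hb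

end Commutator

/-! ### Coordinate frames -/

section Frames

variable {d : ℕ} {N : Type*} [TopologicalSpace N] [ChartedSpace (Model d) N]
  [IsManifold (𝓡 d) ∞ N]

lemma mvfderiv_extChartAt_eq {y z : N} (hz : z ∈ (chartAt (Model d) y).source)
    (v : TangentSpace (𝓡 d) z) : mvfderiv (𝓡 d) (extChartAt (𝓡 d) y) z v =
      (trivializationAt (Model d) (TangentSpace (𝓡 d) : N → Type _) y ⟨z, v⟩).2 := by
  have h := DFunLike.congr_fun
    (TangentBundle.continuousLinearMapAt_trivializationAt (I := 𝓡 d) hz) v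
  rw [Trivialization.continuousLinearMapAt_apply,
    Trivialization.coe_linearMapAt_of_mem _ (by simpa using hz)] at h
  exact h.symm

lemma mvfderiv_extChartAt_extend {y : N} (v : TangentSpace (𝓡 d) y) :
    (fun z ↦ mvfderiv (𝓡 d) (extChartAt (𝓡 d) y) z (FiberBundle.extend (Model d) v z)) =ᶠ[𝓝 y]
      fun _ ↦ (trivializationAt (Model d) (TangentSpace (𝓡 d) : N → Type _) y ⟨y, v⟩).2 := by
  filter_upwards [(chartAt (Model d) y).open_source.mem_nhds (mem_chart_source _ y)] with z hz
  rw [mvfderiv_extChartAt_eq hz]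
  have := congrArg Prod.snd (Trivialization.apply_mk_symm
    (trivializationAt (Model d) (TangentSpace (𝓡 d) : N → Type _) y) (by simpa using hz)
    (trivializationAt (Model d) (TangentSpace (𝓡 d) : N → Type _) y ⟨y, v⟩).2)
  exact this

/-- Both fields are constant in the chart at `y`, so the commutator formula applied to the chart
itself gives zero, and the differential of the chart is injective. Consequently the torsion at `y`
is the bare difference of the derivatives of the extensions. -/
lemma bracket_extend {y : N} (u v : TangentSpace (𝓡 d) y) :
    bracket (FiberBundle.extend (Model d) u) (FiberBundle.extend (Model d) v) y = 0 := by
  have hu := mvfderiv_extChartAt_extend u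
  have hv := mvfderiv_extChartAt_extend v
  have h := mvfderiv_bracket (contMDiffAt_extChartAt (I := 𝓡 d) (n := ∞) (x := y))
    (extend_mdifferentiableAt u) (extend_mdifferentiableAt v)
    (mdifferentiableAt_const.congr_of_eventuallyEq hu)
    (mdifferentiableAt_const.congr_of_eventuallyEq hv)
  rw [mvfderiv_congr hu, mvfderiv_congr hv, mvfderiv_const, mvfderiv_const] at h
  have hinj := isInvertible_mfderiv_extChartAt (I := 𝓡 d) (mem_extChartAt_source (I := 𝓡 d) y)
  refine hinj.injective ?_
  rw [map_zero]
  exact h.trans (by simp; rfl)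

/-- The `i`-th field of the coordinate frame at `p`. -/
def coordField (p : N) (i : Fin d) (y : N) : TangentSpace (𝓡 d) y :=
  (trivializationAt (Model d) (TangentSpace (𝓡 d) : N → Type _) p).symmL ℝ y
    (EuclideanSpace.basisFun (Fin d) ℝ i)

lemma contMDiffOn_coordField (p : N) (i : Fin d) : ContMDiffOn (𝓡 d) (𝓡 d).tangent ∞
    (fun y ↦ (⟨y, coordField p i y⟩ : TangentBundle (𝓡 d) N)) (chartAt (Model d) p).source := by
  set t := trivializationAt (Model d) (TangentSpace (𝓡 d) : N → Type _) p
  intro x hx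
  rw [t.contMDiffWithinAt_section _ hx]
  have : ContMDiffOn (𝓡 d) 𝓘(ℝ, Model d) ∞
    (fun _ : N ↦ EuclideanSpace.basisFun (Fin d) ℝ i) t.baseSet := contMDiffOn_const
  refine (this.congr (fun y hy ↦ ?_)) x hx
  have h := t.continuousLinearMapAt_symmL (R := ℝ) hy (EuclideanSpace.basisFun (Fin d) ℝ i)
  rwa [Trivialization.continuousLinearMapAt_apply, Trivialization.coe_linearMapAt_of_mem _ hy] at h

end Frames

/-! ### Tensors and torsion along a map -/

section Along

variable {k d : ℕ} {M : Type*} [TopologicalSpace M] [ChartedSpace (Model k) M]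
  {N : Type*} [TopologicalSpace N] [ChartedSpace (Model d) N] [IsManifold (𝓡 d) ∞ N]
  {f : M → N} {x : M}

/-- A field along `f` that is differentiable at `x` is near `x` a combination of restrictions of
smooth fields of the ambient manifold. -/
lemma DiffAlong.exists_eq_sum [T2Space N] {V : Π x : M, TangentSpace (𝓡 d) (f x)}
    (hV : DiffAlong k f V x) :
    ∃ (c : Fin d → M → ℝ) (E : Fin d → Π y : N, TangentSpace (𝓡 d) y),
      (∀ i, MDifferentiableAt (𝓡 k) 𝓘(ℝ, ℝ) (c i) x) ∧ (∀ i, IsSmoothField (E i)) ∧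
      ∀ᶠ x' in 𝓝 x, V x' = ∑ i, c i x' • E i (f x') := by
  -- The coordinate fields are only local, whereas the smoothness of `φ` and `η` is expressed
  -- through global fields; hence global fields with the same germs at `f x`.
  choose E hE hE' using fun i : Fin d ↦
    exists_isSmoothField_eventuallyEq (d := d) (f x) (contMDiffOn_coordField (d := d) (f x) i)
  refine ⟨fun i x' ↦ coordAlong f x V x' i, E, fun i ↦ ?_, hE, ?_⟩
  · have hi : MDifferentiableAt 𝓘(ℝ, Model d) 𝓘(ℝ, ℝ) (fun z : Model d ↦ z i)
        (coordAlong f x V x) :=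
      ((EuclideanSpace.proj (𝕜 := ℝ) i).differentiableAt).mdifferentiableAt
    exact hi.comp x (diffAlong_iff.1 hV).2
  · have h : ∀ᶠ x' in 𝓝 x, ∀ i, coordField (f x) i (f x') = E i (f x') :=
      hV.mdifferentiableAt.continuousAt.eventually (eventually_all.2 hE')
    filter_upwards [h, eventually_mem_baseSet hV.mdifferentiableAt] with x' h1 h2
    simp only [← h1, coordField, ← map_smul, ← map_sum]
    have : ∑ i, coordAlong f x V x' i • EuclideanSpace.basisFun (Fin d) ℝ i =
        coordAlong f x V x' := by
      simpa using (EuclideanSpace.basisFun (Fin d) ℝ).sum_repr (coordAlong f x V x')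
    rw [this, coordAlong_eq h2, Trivialization.symmL_continuousLinearMapAt _ h2]

lemma alongDeriv_zero (D : Connection d N) (hf : MDifferentiableAt (𝓡 k) (𝓡 d) f x)
    (v : TangentSpace (𝓡 k) x) :
    alongDeriv D f (fun x' ↦ (0 : TangentSpace (𝓡 d) (f x'))) x v = 0 := by
  have := alongDeriv_comp D (W := 0) hf (mdifferentiableAt_zeroSection ..) v
  rw [D.zero] at this
  exact this

lemma DiffAlong.sum {ι : Type*} {s : Finset ι} {V : ι → Π x : M, TangentSpace (𝓡 d) (f x)}
    (hf : MDifferentiableAt (𝓡 k) (𝓡 d) f x) (hV : ∀ i, DiffAlong k f (V i) x) :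
    DiffAlong k f (fun x' ↦ ∑ i ∈ s, V i x') x := by
  classical
  induction s using Finset.induction_on with
  | empty => simpa using diffAlong_zero hf
  | insert a s ha ih => simpa only [Finset.sum_insert ha] using (hV a).add ih

lemma alongDeriv_sum (D : Connection d N) {ι : Type*} {s : Finset ι}
    {V : ι → Π x : M, TangentSpace (𝓡 d) (f x)} (hf : MDifferentiableAt (𝓡 k) (𝓡 d) f x)
    (hV : ∀ i, DiffAlong k f (V i) x) (v : TangentSpace (𝓡 k) x) :
    alongDeriv D f (fun x' ↦ ∑ i ∈ s, V i x') x v = ∑ i ∈ s, alongDeriv D f (V i) x v := by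
  classical
  induction s using Finset.induction_on with
  | empty => simpa using alongDeriv_zero D hf v
  | insert a s ha ih =>
    simp only [Finset.sum_insert ha]
    rw [alongDeriv_add D (hV a) (DiffAlong.sum hf hV), ih]

lemma alongDeriv_smul_comp (D : Connection d N) {c : M → ℝ} {W : Π y : N, TangentSpace (𝓡 d) y}
    (hf : MDifferentiableAt (𝓡 k) (𝓡 d) f x) (hc : MDifferentiableAt (𝓡 k) 𝓘(ℝ, ℝ) c x)
    (hW : IsSmoothField W) (v : TangentSpace (𝓡 k) x) :
    alongDeriv D f (fun x' ↦ c x' • W (f x')) x v =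
      c x • D W (f x) (df k d f x v) + mvfderiv (𝓡 k) c x v • W (f x) := by
  rw [alongDeriv_smul D hc (.comp hf (hW.mdifferentiableAt _)),
    alongDeriv_comp D hf (hW.mdifferentiableAt _)]

section Tensors

variable [T2Space N] {A : Π y : N, TangentSpace (𝓡 d) y →L[ℝ] TangentSpace (𝓡 d) y}
  {θ : Π y : N, TangentSpace (𝓡 d) y →L[ℝ] ℝ} {V : Π x : M, TangentSpace (𝓡 d) (f x)}

lemma DiffAlong.map (hA : ∀ X, IsSmoothField X → IsSmoothField (fun y ↦ A y (X y)))
    (hV : DiffAlong k f V x) : DiffAlong k f (fun x' ↦ A (f x') (V x')) x := by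
  obtain ⟨c, E, hc, hE, h⟩ := hV.exists_eq_sum
  have hs : DiffAlong k f (fun x' ↦ ∑ i, c i x' • A (f x') (E i (f x'))) x :=
    DiffAlong.sum hV.mdifferentiableAt fun i ↦
      .smul (hc i) (.comp hV.mdifferentiableAt ((hA _ (hE i)).mdifferentiableAt _))
  exact hs.congr (h.mono fun x' hx' ↦ by simp [hx'])

/-- An endomorphism field that is parallel in the direction `df v` commutes with the covariant
derivative along `f` in the direction `v`. -/
lemma alongDeriv_map_of_parallel (D : Connection d N)
    (hA : ∀ X, IsSmoothField X → IsSmoothField (fun y ↦ A y (X y))) {v : TangentSpace (𝓡 k) x}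
    (hpar : ∀ X, IsSmoothField X → D (fun y ↦ A y (X y)) (f x) (df k d f x v) =
      A (f x) (D X (f x) (df k d f x v)))
    (hV : DiffAlong k f V x) :
    alongDeriv D f (fun x' ↦ A (f x') (V x')) x v = A (f x) (alongDeriv D f V x v) := by
  obtain ⟨c, E, hc, hE, h⟩ := hV.exists_eq_sum
  have hf := hV.mdifferentiableAt
  have hAV : ∀ᶠ x' in 𝓝 x, A (f x') (V x') = ∑ i, c i x' • A (f x') (E i (f x')) :=
    h.mono fun x' hx' ↦ by simp [hx']
  rw [alongDeriv_congr D h, alongDeriv_congr D hAV,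
    alongDeriv_sum D hf fun i ↦ .smul (hc i) (.comp hf ((hE i).mdifferentiableAt _)),
    alongDeriv_sum D hf fun i ↦ .smul (hc i) (.comp hf ((hA _ (hE i)).mdifferentiableAt _)),
    map_sum]
  refine Finset.sum_congr rfl fun i _ ↦ ?_
  rw [alongDeriv_smul_comp D hf (hc i) (hE i), alongDeriv_smul_comp D hf (hc i) (hA _ (hE i)),
    hpar _ (hE i), map_add, map_smul, map_smul]

lemma DiffAlong.mdifferentiableAt_form
    (hθ : ∀ X, IsSmoothField X → ContMDiff (𝓡 d) 𝓘(ℝ, ℝ) ∞ (fun y ↦ θ y (X y)))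
    (hV : DiffAlong k f V x) :
    MDifferentiableAt (𝓡 k) 𝓘(ℝ, ℝ) (fun x' ↦ θ (f x') (V x')) x := by
  obtain ⟨c, E, hc, hE, h⟩ := hV.exists_eq_sum
  have hs : MDifferentiableAt (𝓡 k) 𝓘(ℝ, ℝ)
      (fun x' ↦ ∑ i, c i x' * θ (f x') (E i (f x'))) x := by
    have : ∀ i, MDifferentiableAt (𝓡 k) 𝓘(ℝ, ℝ) (fun x' ↦ c i x' * θ (f x') (E i (f x'))) x :=
      fun i ↦ (hc i).mul (((hθ _ (hE i)).mdifferentiableAt (by simp)).comp x hV.mdifferentiableAt)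
    convert MDifferentiableAt.sum (t := Finset.univ) fun i _ ↦ this i using 1
    ext x'
    simp
  exact hs.congr_of_eventuallyEq (h.mono fun x' hx' ↦ by simp [hx'])

end Tensors

section Torsion

variable {X Y : Π x : M, TangentSpace (𝓡 k) x}

lemma diffAlong_pushField [IsManifold (𝓡 k) ∞ M] (hf : ContMDiff (𝓡 k) (𝓡 d) ∞ f)
    (hX : MDifferentiableAt (𝓡 k) (𝓡 k).tangent (fun y ↦ (⟨y, X y⟩ : TangentBundle (𝓡 k) M)) x) :
    DiffAlong k f (pushField (d := d) f X) x := by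
  have h : ContMDiff (𝓡 k).tangent (𝓡 d).tangent ∞ (tangentMap (𝓡 k) (𝓡 d) f) :=
    hf.contMDiff_tangentMap (by simp)
  have h' := h.mdifferentiableAt (by simp) (x := (⟨x, X x⟩ : TangentBundle (𝓡 k) M))
  exact h'.comp x hX

/-- This turns principal parts of pushed-forward fields into derivatives of one vector-valued
function, to which the commutator formula applies. -/
lemma coordAlong_pushField (hf : ContMDiff (𝓡 k) (𝓡 d) ∞ f) :
    coordAlong f x (pushField f X) =ᶠ[𝓝 x]
      fun x' ↦ mvfderiv (𝓡 k) (extChartAt (𝓡 d) (f x) ∘ f) x' (X x') := by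
  filter_upwards [eventually_mem_baseSet (hf.mdifferentiableAt (by simp))] with x' hx'
  have hx'' : f x' ∈ (chartAt (Model d) (f x)).source := by simpa using hx'
  have := mfderiv_comp_apply x' (mdifferentiableAt_extChartAt (I := 𝓡 d) hx'')
    (hf.mdifferentiableAt (by simp)) (X x')
  exact (mvfderiv_extChartAt_eq hx'' _).symm.trans this.symm

/-- The torsion of the pull-back along `f` of a connection is the pull-back of the torsion. -/
lemma alongDeriv_pushField_sub [IsManifold (𝓡 k) ∞ M] (D : Connection d N)
    (hf : ContMDiff (𝓡 k) (𝓡 d) ∞ f)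
    (hX : MDifferentiableAt (𝓡 k) (𝓡 k).tangent (fun y ↦ (⟨y, X y⟩ : TangentBundle (𝓡 k) M)) x)
    (hY : MDifferentiableAt (𝓡 k) (𝓡 k).tangent (fun y ↦ (⟨y, Y y⟩ : TangentBundle (𝓡 k) M)) x) :
    alongDeriv D f (pushField f Y) x (X x) - alongDeriv D f (pushField f X) x (Y x) =
      df k d f x (bracket X Y x) + D.torsion (f x) (df k d f x (X x)) (df k d f x (Y x)) := by
  have hcX := coordAlong_pushField (x := x) (X := X) hf
  have hcY := coordAlong_pushField (x := x) (X := Y) hf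
  have hG : ContMDiffAt (𝓡 k) 𝓘(ℝ, Model d) ∞ (extChartAt (𝓡 d) (f x) ∘ f) x :=
    (contMDiffAt_extChartAt (I := 𝓡 d)).comp x hf.contMDiffAt
  have hbr := mvfderiv_bracket hG hX hY
    ((diffAlong_iff.1 (diffAlong_pushField hf hX)).2.congr_of_eventuallyEq hcX.symm)
    ((diffAlong_iff.1 (diffAlong_pushField hf hY)).2.congr_of_eventuallyEq hcY.symm)
  rw [← mvfderiv_congr hcX, ← mvfderiv_congr hcY] at hbr
  have hb : f x ∈ (trivializationAt (Model d) (TangentSpace (𝓡 d) : N → Type _) (f x)).baseSet :=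
    FiberBundle.mem_baseSet_trivializationAt' _
  have hbr' := (coordAlong_pushField (x := x) (X := bracket X Y) hf).self_of_nhds
  replace hbr' := hbr'.trans hbr
  rw [coordAlong_eq hb] at hbr'
  -- The principal parts contribute the bracket; the derivatives of the constant-coefficient
  -- extensions contribute the torsion.
  have hp : alongPrincipal f (pushField f Y) x (X x) - alongPrincipal f (pushField f X) x (Y x) =
      df k d f x (bracket X Y x) := by
    rw [alongPrincipal, alongPrincipal, ← map_sub, ← hbr',
      Trivialization.symmL_continuousLinearMapAt _ hb]
    rfl
  have ht := D.torsion_apply_eq_extend (df k d f x (X x)) (df k d f x (Y x))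
  rw [FiberBundle.extend_apply_self, FiberBundle.extend_apply_self] at ht
  have hz := bracket_extend (df k d f x (X x)) (df k d f x (Y x))
  rw [bracket] at hz
  rw [hz, sub_zero] at ht
  rw [alongDeriv_eq, alongDeriv_eq, ht, ← hp]
  simp only [pushField]
  abel

end Torsion

end Along

/-! ### Immersions and local retractions -/

section Retraction

variable {k d : ℕ} {M : Type*} [TopologicalSpace M] [ChartedSpace (Model k) M]
  {N : Type*} [TopologicalSpace N] [ChartedSpace (Model d) N] {f : M → N}

lemma mfderiv_retraction_df {U : Set N} {r : N → M} {x : M}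
    (hf : MDifferentiableAt (𝓡 k) (𝓡 d) f x) (hU : IsOpen U) (hx : f x ∈ U)
    (hr : ContMDiffOn (𝓡 d) (𝓡 k) ∞ r U) (hrf : ∀ᶠ x' in 𝓝 x, r (f x') = x')
    (v : TangentSpace (𝓡 k) x) :
    mfderiv (𝓡 d) (𝓡 k) r (f x) (df k d f x v) = v := by
  have hr' : MDifferentiableAt (𝓡 d) (𝓡 k) r (f x) :=
    (hr.contMDiffAt (hU.mem_nhds hx)).mdifferentiableAt (by simp)
  have h := mfderiv_comp_apply x hr' hf v
  have h' : mfderiv (𝓡 k) (𝓡 k) (r ∘ f) x = mfderiv (𝓡 k) (𝓡 k) id x :=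
    Filter.EventuallyEq.mfderiv_eq hrf
  rw [h', mfderiv_id] at h
  exact h.symm

/-- In adapted charts `f` is `z ↦ (z, 0)` up to a linear equivalence, and `r` is the first
projection, restricted to where it lands in the target of the domain chart. -/
lemma exists_local_retraction (hf : Manifold.IsImmersion (𝓡 k) (𝓡 d) ∞ f) (x : M) :
    ∃ (U : Set N) (r : N → M), IsOpen U ∧ f x ∈ U ∧ ContMDiffOn (𝓡 d) (𝓡 k) ∞ r U ∧
      ∀ᶠ x' in 𝓝 x, r (f x') = x' := by
  obtain ⟨F, _, _, h⟩ := hf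
  replace h := h x
  set a := h.domChart.extend (𝓡 k) with ha
  set b := h.codChart.extend (𝓡 d) with hb
  have hbf : ∀ x' ∈ h.domChart.source, b (f x') = h.equiv (a x', 0) := by
    intro x' hx'
    have hx : x' ∈ a.source := by rwa [ha, OpenPartialHomeomorph.extend_source]
    have := h.writtenInCharts (a.map_source hx)
    simpa only [Function.comp_apply, ← ha, ← hb, a.left_inv hx] using this
  have hcont : ContMDiffOn (𝓡 d) 𝓘(ℝ, Model k) ∞ (fun y ↦ (h.equiv.symm (b y)).1)
      h.codChart.source := by
    have h1 : ContMDiffOn (𝓡 d) 𝓘(ℝ, Model d) ∞ b h.codChart.source :=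
      h.codChart.contMDiffOn_extend h.codChart_mem_maximalAtlas
    have h2 : ContDiff ℝ ∞ (fun z : Model d ↦ (h.equiv.symm z).1) :=
      (contDiff_fst.comp h.equiv.symm.contDiff)
    exact h2.contMDiff.comp_contMDiffOn h1
  have htarget : IsOpen a.target := h.domChart.isOpen_extend_target
  refine ⟨h.codChart.source ∩ (fun y ↦ (h.equiv.symm (b y)).1) ⁻¹' a.target,
    fun y ↦ a.symm (h.equiv.symm (b y)).1,
    hcont.continuousOn.isOpen_inter_preimage h.codChart.open_source htarget,
    ⟨h.mem_codChart_source, ?_⟩, ?_, ?_⟩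
  · simp only [Set.mem_preimage, hbf x h.mem_domChart_source,
      ContinuousLinearEquiv.symm_apply_apply]
    exact a.map_source (by rw [ha, OpenPartialHomeomorph.extend_source]; exact h.mem_domChart_source)
  · have h3 : ContMDiffOn 𝓘(ℝ, Model k) (𝓡 k) ∞ a.symm a.target := by
      have := contMDiffOn_extend_symm (I := 𝓡 k) h.domChart_mem_maximalAtlas
      rwa [← OpenPartialHomeomorph.extend_target'] at this
    exact h3.comp (hcont.mono Set.inter_subset_left) Set.inter_subset_right
  · filter_upwards [h.domChart.open_source.mem_nhds h.mem_domChart_source] with x' hx'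
    simp only [hbf x' hx', ContinuousLinearEquiv.symm_apply_apply]
    exact a.left_inv (by rwa [ha, OpenPartialHomeomorph.extend_source])

lemma df_injective (hf : Manifold.IsImmersion (𝓡 k) (𝓡 d) ∞ f) (x : M) :
    Function.Injective (df k d f x) := by
  obtain ⟨U, r, hU, hx, hr, hrf⟩ := exists_local_retraction hf x
  exact Function.LeftInverse.injective
    (mfderiv_retraction_df (hf.contMDiff.mdifferentiableAt (by simp)) hU hx hr hrf)

end Retraction

section Immersion

variable {k d : ℕ} {M : Type*} [TopologicalSpace M] [ChartedSpace (Model k) M]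
  [IsManifold (𝓡 k) ∞ M]
  {N : Type*} [TopologicalSpace N] [ChartedSpace (Model d) N] [IsManifold (𝓡 d) ∞ N]
  {f : M → N}

/-- A field on the domain of an immersion is smooth if its push-forward is the restriction of a
smooth field. -/
lemma isSmoothField_of_pushField (hf : Manifold.IsImmersion (𝓡 k) (𝓡 d) ∞ f)
    {W : Π y : N, TangentSpace (𝓡 d) y} (hW : IsSmoothField W) {Y : Π x : M, TangentSpace (𝓡 k) x}
    (hY : ∀ x, df k d f x (Y x) = W (f x)) : IsSmoothField Y := by
  intro x
  obtain ⟨U, r, hU, hx, hr, hrf⟩ := exists_local_retraction hf x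
  have hs : ContMDiff (𝓡 k) (𝓡 d).tangent ∞ (fun x' ↦ (⟨f x', W (f x')⟩ : TangentBundle (𝓡 d) N)) :=
    hW.comp hf.contMDiff
  have ht := hr.contMDiffOn_tangentMapWithin (m := ∞) (by simp) hU.uniqueMDiffOn
  have hopen : IsOpen (TotalSpace.proj ⁻¹' U : Set (TangentBundle (𝓡 d) N)) :=
    hU.preimage (FiberBundle.continuous_proj _ _)
  have ht' := ht.contMDiffAt (x := (⟨f x, W (f x)⟩ : TangentBundle (𝓡 d) N)) (hopen.mem_nhds hx)
  -- Near `x`, `Y = dr(W ∘ f)` because `dr ∘ df = id`.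
  refine (ht'.comp x hs.contMDiffAt).congr_of_eventuallyEq ?_
  filter_upwards [eventually_eventually_nhds.2 hrf,
    hf.contMDiff.continuous.continuousAt.eventually (hU.mem_nhds hx)] with x' h1 h2
  have h3 := mfderiv_retraction_df (hf.contMDiff.mdifferentiableAt (by simp)) hU h2 hr h1 (Y x')
  rw [hY] at h3
  rw [Function.comp_apply, tangentMapWithin, mfderivWithin_of_isOpen hU h2]
  refine Bundle.TotalSpace.ext h1.self_of_nhds.symm ?_
  exact heq_of_eq h3.symm

end Immersion

/-! ### Tangential and normal components, second fundamental form -/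

section Parts

variable {k d : ℕ} {M : Type*} [TopologicalSpace M] [ChartedSpace (Model k) M]
  {N : Type*} [TopologicalSpace N] [ChartedSpace (Model d) N]
  [RiemannianBundle (fun y : N ↦ TangentSpace (𝓡 d) y)]
  {f : M → N} {x : M}

/-- Orthogonal projection onto the range of `df` provides the existence without which the
`Classical.epsilon` in `tangentPart` carries no information. -/
lemma exists_tangentPart (f : M → N) (x : M) (w : TangentSpace (𝓡 d) (f x)) :
    ∃ u : TangentSpace (𝓡 k) x, ∀ v : TangentSpace (𝓡 k) x,
      metric (w - df k d f x u) (df k d f x v) = 0 := by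
  have : FiniteDimensional ℝ (TangentSpace (𝓡 k) x) :=
    inferInstanceAs (FiniteDimensional ℝ (Model k))
  let K : Submodule ℝ (TangentSpace (𝓡 d) (f x)) := LinearMap.range (df k d f x).toLinearMap
  have : FiniteDimensional ℝ K := LinearMap.finiteDimensional_range _
  obtain ⟨u, hu⟩ : K.starProjection w ∈ K := Submodule.starProjection_apply_mem _ _
  refine ⟨u, fun v ↦ ?_⟩
  have hu' : df k d f x u = K.starProjection w := hu
  rw [hu', metric]
  exact Submodule.starProjection_inner_eq_zero w _ ⟨v, rfl⟩

lemma metric_sub_df_tangentPart (w : TangentSpace (𝓡 d) (f x)) (v : TangentSpace (𝓡 k) x) :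
    metric (w - df k d f x (tangentPart k f x w)) (df k d f x v) = 0 :=
  Classical.epsilon_spec (exists_tangentPart f x w) v

lemma tangentPart_eq (hf : Function.Injective (df k d f x)) {w : TangentSpace (𝓡 d) (f x)}
    {u : TangentSpace (𝓡 k) x} (h : ∀ v, metric (w - df k d f x u) (df k d f x v) = 0) :
    tangentPart k f x w = u := by
  apply hf
  rw [← sub_eq_zero, ← map_sub]
  refine inner_self_eq_zero (𝕜 := ℝ).1 ?_
  have h1 := h (tangentPart k f x w - u)
  have h2 := metric_sub_df_tangentPart w (tangentPart k f x w - u)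
  simp only [metric, inner_sub_left] at h1 h2
  nth_rw 1 [map_sub]
  rw [inner_sub_left]
  linarith

lemma tangentPart_df (hf : Function.Injective (df k d f x)) (u : TangentSpace (𝓡 k) x) :
    tangentPart k f x (df k d f x u) = u :=
  tangentPart_eq hf fun v ↦ by simp [metric]

lemma tangentPart_add (hf : Function.Injective (df k d f x)) (w w' : TangentSpace (𝓡 d) (f x)) :
    tangentPart k f x (w + w') = tangentPart k f x w + tangentPart k f x w' :=
  tangentPart_eq hf fun v ↦ by
    have h1 := metric_sub_df_tangentPart w v
    have h2 := metric_sub_df_tangentPart w' v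
    simp only [metric, map_add, inner_sub_left, inner_add_left] at h1 h2 ⊢
    linarith

lemma tangentPart_smul (hf : Function.Injective (df k d f x)) (c : ℝ)
    (w : TangentSpace (𝓡 d) (f x)) :
    tangentPart k f x (c • w) = c • tangentPart k f x w :=
  tangentPart_eq hf fun v ↦ by
    have h1 := metric_sub_df_tangentPart w v
    simp only [metric] at h1 ⊢
    rw [map_smul, ← smul_sub, inner_smul_left, h1, mul_zero]

lemma df_tangentPart (hf : Function.Injective (df k d f x)) {w : TangentSpace (𝓡 d) (f x)}
    (hw : w ∈ Set.range (df k d f x)) : df k d f x (tangentPart k f x w) = w := by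
  obtain ⟨u, rfl⟩ := hw
  rw [tangentPart_df hf]

lemma normalPart_eq_zero (hf : Function.Injective (df k d f x)) {w : TangentSpace (𝓡 d) (f x)}
    (hw : w ∈ Set.range (df k d f x)) : normalPart k f x w = 0 := by
  rw [normalPart, df_tangentPart hf hw, sub_self]

lemma normalPart_add (hf : Function.Injective (df k d f x)) (w w' : TangentSpace (𝓡 d) (f x)) :
    normalPart k f x (w + w') = normalPart k f x w + normalPart k f x w' := by
  rw [normalPart, tangentPart_add hf, map_add, normalPart, normalPart]
  abel

lemma normalPart_smul (hf : Function.Injective (df k d f x)) (c : ℝ)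
    (w : TangentSpace (𝓡 d) (f x)) :
    normalPart k f x (c • w) = c • normalPart k f x w := by
  rw [normalPart, tangentPart_smul hf, map_smul, normalPart, smul_sub]

lemma normalPart_add_of_mem_range (hf : Function.Injective (df k d f x))
    (w : TangentSpace (𝓡 d) (f x)) {w' : TangentSpace (𝓡 d) (f x)}
    (hw' : w' ∈ Set.range (df k d f x)) : normalPart k f x (w + w') = normalPart k f x w := by
  rw [normalPart_add hf, normalPart_eq_zero hf hw', add_zero]

end Parts

section SecondFundForm

variable {k d : ℕ} {M : Type*} [TopologicalSpace M] [ChartedSpace (Model k) M]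
  [IsManifold (𝓡 k) ∞ M]
  {N : Type*} [TopologicalSpace N] [ChartedSpace (Model d) N] [IsManifold (𝓡 d) ∞ N]
  [RiemannianBundle (fun y : N ↦ TangentSpace (𝓡 d) y)]
  {f : M → N} {x : M}

/-- The Leibniz term is a multiple of `df Y`, which the normal part kills; the right side is thus
tensorial in `Y`, and any extension may replace the one in the definition. -/
lemma secondFundForm_eq (D : Connection d N) (hf : Manifold.IsImmersion (𝓡 k) (𝓡 d) ∞ f)
    {Y : Π x : M, TangentSpace (𝓡 k) x}
    (hY : MDifferentiableAt (𝓡 k) (𝓡 k).tangent (fun y ↦ (⟨y, Y y⟩ : TangentBundle (𝓡 k) M)) x)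
    (u : TangentSpace (𝓡 k) x) :
    secondFundForm D f x u (Y x) = normalPart k f x (alongDeriv D f (pushField f Y) x u) := by
  have hinj := df_injective hf x
  have key : TensorialAt (𝓡 k) (Model k) (fun Y : Π x : M, TangentSpace (𝓡 k) x ↦
      normalPart k f x (alongDeriv D f (pushField f Y) x u)) x := by
    constructor
    · intro c σ hc hσ
      have h : pushField f (c • σ) = fun x' ↦ c x' • pushField (d := d) f σ x' := by
        ext x'
        exact map_smul (df k d f x') _ _
      have hmem : mvfderiv (𝓡 k) c x u • pushField f σ x ∈ Set.range (df k d f x) :=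
        ⟨mvfderiv (𝓡 k) c x u • σ x, map_smul ..⟩
      rw [h, alongDeriv_smul D hc (diffAlong_pushField hf.contMDiff hσ),
        normalPart_add_of_mem_range hinj _ hmem, normalPart_smul hinj]
    · intro σ σ' hσ hσ'
      have h : pushField f (σ + σ') = fun x' ↦ pushField (d := d) f σ x' + pushField f σ' x' := by
        ext x'
        exact map_add (df k d f x') _ _
      rw [h, alongDeriv_add D (diffAlong_pushField hf.contMDiff hσ)
        (diffAlong_pushField hf.contMDiff hσ'), normalPart_add hinj]
  exact key.pointwise (extend_mdifferentiableAt _) hY (by simp)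

lemma secondFundForm_add_right (D : Connection d N) (hf : Manifold.IsImmersion (𝓡 k) (𝓡 d) ∞ f)
    (u v w : TangentSpace (𝓡 k) x) :
    secondFundForm D f x u (v + w) = secondFundForm D f x u v + secondFundForm D f x u w := by
  have hv := extend_mdifferentiableAt v
  have hw := extend_mdifferentiableAt w
  have h := secondFundForm_eq D hf (mdifferentiableAt_add_section hv hw) u
  have hp : pushField f (FiberBundle.extend (Model k) v + FiberBundle.extend (Model k) w) =
      fun x' ↦ pushField (d := d) f (FiberBundle.extend (Model k) v) x' +
        pushField f (FiberBundle.extend (Model k) w) x' := by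
    ext x'
    exact map_add (df k d f x') _ _
  rw [hp, alongDeriv_add D (diffAlong_pushField hf.contMDiff hv)
    (diffAlong_pushField hf.contMDiff hw), normalPart_add (df_injective hf x)] at h
  simpa [secondFundForm] using h

lemma secondFundForm_smul_right (D : Connection d N)
    (hf : Manifold.IsImmersion (𝓡 k) (𝓡 d) ∞ f) (c : ℝ) (u v : TangentSpace (𝓡 k) x) :
    secondFundForm D f x u (c • v) = c • secondFundForm D f x u v := by
  have hv := extend_mdifferentiableAt v
  have h := secondFundForm_eq D hf hv.smul_const_section u (Y := c • FiberBundle.extend (Model k) v)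
  have hp : pushField f (c • FiberBundle.extend (Model k) v) =
      fun x' ↦ c • pushField (d := d) f (FiberBundle.extend (Model k) v) x' := by
    ext x'
    exact map_smul (df k d f x') _ _
  rw [hp, alongDeriv_smul D mdifferentiableAt_const (diffAlong_pushField hf.contMDiff hv),
    mvfderiv_const, normalPart_add_of_mem_range (df_injective hf x) _ ⟨0, by simp⟩,
    normalPart_smul (df_injective hf x)] at h
  simpa [secondFundForm] using h

/-- Without torsion the two derivatives differ by `df` of a bracket, which is tangential. -/
lemma secondFundForm_comm (D : Connection d N) (hD : D.torsion = 0)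
    (hf : Manifold.IsImmersion (𝓡 k) (𝓡 d) ∞ f) (u v : TangentSpace (𝓡 k) x) :
    secondFundForm D f x u v = secondFundForm D f x v u := by
  have h := alongDeriv_pushField_sub D hf.contMDiff (extend_mdifferentiableAt u)
    (extend_mdifferentiableAt v)
  rw [FiberBundle.extend_apply_self, FiberBundle.extend_apply_self, hD, sub_eq_iff_eq_add'] at h
  rw [secondFundForm, h, secondFundForm]
  exact normalPart_add_of_mem_range (df_injective hf x) _ ⟨_, (add_zero _).symm⟩

end SecondFundForm

/-! ### Ambient geometry: normality and the semisymmetric connection -/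

section Normal

variable {d : ℕ} {N : Type*} [TopologicalSpace N] [ChartedSpace (Model d) N]
  [IsManifold (𝓡 d) ∞ N] [RiemannianBundle (fun y : N ↦ TangentSpace (𝓡 d) y)]
  {S : AlmostContactMetric d N}

/-- Since `φξ = 0`, applying `φ` to `N(ξ, X) = 0` gives `[ξ, φX] - φ[ξ, X] = η([ξ, φX])ξ`. The right
side vanishes because the `η`-component of `N(ξ, φX)` is `-η([ξ, φX])`. -/
lemma AlmostContactMetric.IsNormal.bracket_ξ_φ (hS : S.IsNormal)
    {X : Π y : N, TangentSpace (𝓡 d) y} (hX : IsSmoothField X) (y : N) :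
    bracket S.ξ (S.φField X) y = S.φ y (bracket S.ξ X y) := by
  have h0 : S.φField S.ξ = 0 := funext S.φ_ξ
  have hη : S.ηFun S.ξ = fun _ ↦ 1 := funext S.η_ξ
  have hηφ : S.ηFun (S.φField X) = fun _ ↦ 0 := funext fun y ↦ S.η_φ y (X y)
  have key : S.η y (bracket S.ξ (S.φField X) y) = 0 := by
    have h := congrArg (S.η y) (hS S.ξ (S.φField X) S.smooth_ξ (S.smooth_φ X hX) y)
    simp only [AlmostContactMetric.nijenhuis, AlmostContactMetric.twoDη, h0, hη, hηφ, dirDeriv,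
      mvfderiv_const, map_add, map_sub, map_smul, S.η_φ, S.η_ξ, bracket,
      VectorField.mlieBracket_zero_left] at h
    simpa [AlmostContactMetric.ηFun] using h
  have h := congrArg (S.φ y) (hS S.ξ X S.smooth_ξ hX y)
  simp only [AlmostContactMetric.nijenhuis, h0, map_add, map_sub, map_smul, S.φ_ξ, bracket,
      VectorField.mlieBracket_zero_left, S.φ_φ] at h
  simp only [bracket] at key
  rw [key] at h
  simp only [smul_zero, zero_smul, add_zero, map_zero, Pi.zero_apply, map_neg, neg_zero, sub_zero,
    zero_add, sub_neg_eq_add] at h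
  rwa [neg_add_eq_zero, eq_comm] at h

end Normal

section Ambient

variable {d : ℕ} {N : Type*} [TopologicalSpace N] [ChartedSpace (Model d) N]
  [IsManifold (𝓡 d) ∞ N] [RiemannianBundle (fun y : N ↦ TangentSpace (𝓡 d) y)]
  [IsContMDiffRiemannianBundle (𝓡 d) ∞ (Model d) (fun y : N ↦ TangentSpace (𝓡 d) y)]
  {S : AlmostContactMetric d N} {β : N → ℝ} {D Dt : Connection d N}

/-- The difference of two metric connections is skew-adjoint. -/
lemma inner_difference_add (hD : D.IsMetricCompatible) (hDt : Dt.IsMetricCompatible) {y : N}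
    (u v w : TangentSpace (𝓡 d) y) :
    inner ℝ (Dt (FiberBundle.extend (Model d) v) y u - D (FiberBundle.extend (Model d) v) y u) w +
      inner ℝ v (Dt (FiberBundle.extend (Model d) w) y u -
        D (FiberBundle.extend (Model d) w) y u) = 0 := by
  have h := hD.mvfderiv_inner_eq (FiberBundle.extend (Model d) u)
    (extend_mdifferentiableAt v) (extend_mdifferentiableAt w)
  have h' := hDt.mvfderiv_inner_eq (FiberBundle.extend (Model d) u)
    (extend_mdifferentiableAt v) (extend_mdifferentiableAt w)
  simp only [FiberBundle.extend_apply_self] at h h'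
  rw [inner_sub_left, inner_sub_right]
  linarith

/-- The brackets in the two torsions cancel, so the antisymmetric part of the difference tensor is
the torsion of `Dt`. -/
lemma difference_sub_difference (hD : D.torsion = 0) (hDt : IsSemisymmetricMetric S.η Dt) {y : N}
    (u v : TangentSpace (𝓡 d) y) :
    (Dt (FiberBundle.extend (Model d) v) y u - D (FiberBundle.extend (Model d) v) y u) -
      (Dt (FiberBundle.extend (Model d) u) y v - D (FiberBundle.extend (Model d) u) y v) =
      S.η y v • u - S.η y u • v := by
  have h := D.torsion_apply_eq_extend u v
  have h' := Dt.torsion_apply_eq_extend u v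
  rw [FiberBundle.extend_apply_self, FiberBundle.extend_apply_self] at h h'
  rw [hDt.torsion_eq] at h'
  rw [hD] at h
  have h0 : (0 : TangentSpace (𝓡 d) y) = _ := h
  rw [h', ← sub_zero (_ - _ - VectorField.mlieBracket _ _ _ _), h0]
  abel

/-- The semisymmetric metric connection in terms of the Levi-Civita connection. -/
lemma semisymmetric_apply (hD : IsLeviCivita D) (hDt : IsSemisymmetricMetric S.η Dt)
    {W : Π y : N, TangentSpace (𝓡 d) y} {y : N}
    (hW : MDifferentiableAt (𝓡 d) (𝓡 d).tangent (fun y ↦ (⟨y, W y⟩ : TangentBundle (𝓡 d) N)) y)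
    (u : TangentSpace (𝓡 d) y) :
    Dt W y u = D W y u + S.η y (W y) • u - metric u (W y) • S.ξ y := by
  have hd {V : Π y : N, TangentSpace (𝓡 d) y}
      (hV : MDifferentiableAt (𝓡 d) (𝓡 d).tangent (fun y ↦ (⟨y, V y⟩ : TangentBundle (𝓡 d) N)) y) :=
    Dt.isCovariantDerivativeOnUniv.difference_apply D.isCovariantDerivativeOnUniv
      (Set.mem_univ y) hV
  have h1 := hd hW
  have h2 := hd (extend_mdifferentiableAt (W y))
  rw [FiberBundle.extend_apply_self, h1] at h2
  replace h2 := DFunLike.congr_fun h2 u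
  simp only [sub_apply] at h2
  rw [add_sub_assoc, ← sub_eq_iff_eq_add', h2]
  generalize W y = v
  refine ext_inner_right ℝ fun w ↦ ?_
  -- Koszul's argument: three cyclic instances of skew-adjointness and three of the
  -- antisymmetrization determine the difference tensor.
  have s1 := inner_difference_add hD.metric hDt.metric u v w
  have s2 := inner_difference_add hD.metric hDt.metric v w u
  have s3 := inner_difference_add hD.metric hDt.metric w u v
  have t1 := congrArg (inner ℝ w) (difference_sub_difference hD.torsion_eq_zero hDt u v)
  have t2 := congrArg (inner ℝ u) (difference_sub_difference hD.torsion_eq_zero hDt v w)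
  have t3 := congrArg (inner ℝ v) (difference_sub_difference hD.torsion_eq_zero hDt w u)
  have e := S.metric_ξ y w
  generalize Dt (FiberBundle.extend (Model d) v) y u - D (FiberBundle.extend (Model d) v) y u =
    a at *
  generalize Dt (FiberBundle.extend (Model d) w) y u - D (FiberBundle.extend (Model d) w) y u =
    b at *
  generalize Dt (FiberBundle.extend (Model d) w) y v - D (FiberBundle.extend (Model d) w) y v =
    c at *
  generalize Dt (FiberBundle.extend (Model d) u) y v - D (FiberBundle.extend (Model d) u) y v =
    a' at *
  generalize Dt (FiberBundle.extend (Model d) u) y w - D (FiberBundle.extend (Model d) u) y w =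
    b' at *
  generalize Dt (FiberBundle.extend (Model d) v) y w - D (FiberBundle.extend (Model d) v) y w =
    c' at *
  simp only [metric, inner_sub_left, inner_sub_right, real_inner_smul_left,
    real_inner_smul_right] at *
  rw [real_inner_comm u w, real_inner_comm v w] at t1
  rw [real_inner_comm u v] at t3
  rw [real_inner_comm w (S.ξ y), e]
  linarith [real_inner_comm a w, real_inner_comm c u, real_inner_comm b' v]

lemma semisymmetric_apply_ξ (hD : IsLeviCivita D) (hS : IsSQSasakian S β D)
    (hDt : IsSemisymmetricMetric S.η Dt) (y : N) (u : TangentSpace (𝓡 d) y) :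
    Dt S.ξ y u = -(β y • S.φ y u) + u - S.η y u • S.ξ y := by
  rw [semisymmetric_apply hD hDt (S.smooth_ξ.mdifferentiableAt y), hS.D_ξ, S.η_ξ, one_smul, S.metric_ξ]

/-- On an SQ-Sasakian manifold `φ` is parallel in the direction `ξ`. -/
lemma IsSQSasakian.D_φ_ξ (hD : IsLeviCivita D) (hS : IsSQSasakian S β D)
    {X : Π y : N, TangentSpace (𝓡 d) y} (hX : IsSmoothField X) (y : N) :
    D (fun y ↦ S.φ y (X y)) y (S.ξ y) = S.φ y (D X y (S.ξ y)) := by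
  have h1 := CovariantDerivative.torsion_eq_zero_iff D |>.1 hD.torsion_eq_zero
    (S.smooth_ξ.mdifferentiableAt y) (hX.mdifferentiableAt y)
  have h2 := CovariantDerivative.torsion_eq_zero_iff D |>.1 hD.torsion_eq_zero
    (S.smooth_ξ.mdifferentiableAt y) ((S.smooth_φ X hX).mdifferentiableAt y)
  have h3 := hS.normal.bracket_ξ_φ hX y
  rw [hS.D_ξ] at h1 h2
  -- Now `D_ξ(φX) - D_{φX}ξ = φ(D_ξ X - D_X ξ)`, and the terms in the derivative of `ξ` agree: both
  -- `D_{φX}ξ` and `φ(D_X ξ)` equal `-βφ²X`.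
  have h4 := (h2.trans h3).trans (congrArg (S.φ y) h1.symm)
  rw [map_sub, map_neg, map_smul] at h4
  exact sub_left_injective h4

/-- In the direction `ξ` the correction `η(W)ξ - g(ξ,W)ξ` vanishes, so both connections agree there.
-/
lemma semisymmetric_apply_φ_ξ (hD : IsLeviCivita D) (hS : IsSQSasakian S β D)
    (hDt : IsSemisymmetricMetric S.η Dt)
    {X : Π y : N, TangentSpace (𝓡 d) y} (hX : IsSmoothField X) (y : N) :
    Dt (fun y ↦ S.φ y (X y)) y (S.ξ y) = S.φ y (Dt X y (S.ξ y)) := by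
  have h (W : Π y : N, TangentSpace (𝓡 d) y) (hW : IsSmoothField W) :
      Dt W y (S.ξ y) = D W y (S.ξ y) := by
    have := S.metric_ξ y (W y)
    rw [metric, real_inner_comm] at this
    rw [semisymmetric_apply hD hDt (hW.mdifferentiableAt y), metric, this, add_sub_cancel_right]
  rw [h _ (S.smooth_φ X hX), h _ hX, hS.D_φ_ξ hD hX]

end Ambient

section Along

variable {k d : ℕ} {M : Type*} [TopologicalSpace M] [ChartedSpace (Model k) M]
  {N : Type*} [TopologicalSpace N] [ChartedSpace (Model d) N]
  [IsManifold (𝓡 d) ∞ N] [RiemannianBundle (fun y : N ↦ TangentSpace (𝓡 d) y)]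
  [IsContMDiffRiemannianBundle (𝓡 d) ∞ (Model d) (fun y : N ↦ TangentSpace (𝓡 d) y)]
  {S : AlmostContactMetric d N} {β : N → ℝ} {D Dt : Connection d N} {f : M → N} {x : M}

lemma alongDeriv_semisymmetric (hD : IsLeviCivita D)
    (hDt : IsSemisymmetricMetric S.η Dt) (V : Π x : M, TangentSpace (𝓡 d) (f x))
    (v : TangentSpace (𝓡 k) x) :
    alongDeriv Dt f V x v = alongDeriv D f V x v + S.η (f x) (V x) • df k d f x v -
      metric (df k d f x v) (V x) • S.ξ (f x) := by
  rw [alongDeriv_eq, alongDeriv_eq,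
    semisymmetric_apply hD hDt (extend_mdifferentiableAt _), FiberBundle.extend_apply_self]
  abel

lemma alongDeriv_semisymmetric_ξ (hD : IsLeviCivita D) (hS : IsSQSasakian S β D)
    (hDt : IsSemisymmetricMetric S.η Dt) (hf : MDifferentiableAt (𝓡 k) (𝓡 d) f x)
    (v : TangentSpace (𝓡 k) x) :
    alongDeriv Dt f (fun x' ↦ S.ξ (f x')) x v =
      -(β (f x) • S.φ (f x) (df k d f x v)) + df k d f x v -
        S.η (f x) (df k d f x v) • S.ξ (f x) := by
  rw [alongDeriv_comp Dt hf (S.smooth_ξ.mdifferentiableAt _), semisymmetric_apply_ξ hD hS hDt]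

end Along

/-! ### Vanishing `h` implies pseudo-parallelism -/

section PseudoParallel

variable {k d : ℕ} {M : Type*} [TopologicalSpace M] [ChartedSpace (Model k) M]
  {N : Type*} [TopologicalSpace N] [ChartedSpace (Model d) N]
  [IsManifold (𝓡 d) ∞ N] [RiemannianBundle (fun y : N ↦ TangentSpace (𝓡 d) y)]
  {D : Connection d N} {f : M → N}

lemma normalConn_zero (hf : Manifold.IsImmersion (𝓡 k) (𝓡 d) ∞ f)
    (X : Π x : M, TangentSpace (𝓡 k) x) : normalConn D f X (fun _ ↦ 0) = fun _ ↦ 0 := by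
  funext x
  rw [normalConn, alongDeriv_zero D (hf.contMDiff.mdifferentiableAt (by simp)),
    normalPart_eq_zero (df_injective hf x) ⟨0, map_zero _⟩]

lemma isDeszczPseudoParallel_of_secondFundForm_eq_zero [IsManifold (𝓡 k) ∞ M]
    (hf : Manifold.IsImmersion (𝓡 k) (𝓡 d) ∞ f)
    (h0 : ∀ (x : M) (u v : TangentSpace (𝓡 k) x), secondFundForm D f x u v = 0) (W : Set M)
    (L : W → ℝ) : IsDeszczPseudoParallel k D f W L := by
  intro X Y Z U _ _ _ _ x
  simp only [curvActionSecondFundForm, tachibana, h0, normalCurv, normalConn_zero hf]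
  simp

end PseudoParallel

/-! ### Invariant submanifolds -/

section Submanifold

variable {k d : ℕ} {M : Type*} [TopologicalSpace M] [ChartedSpace (Model k) M]
  {N : Type*} [TopologicalSpace N] [ChartedSpace (Model d) N]
  [IsManifold (𝓡 d) ∞ N] [RiemannianBundle (fun y : N ↦ TangentSpace (𝓡 d) y)]
  [IsContMDiffRiemannianBundle (𝓡 d) ∞ (Model d) (fun y : N ↦ TangentSpace (𝓡 d) y)]
  {S : AlmostContactMetric d N} {β : N → ℝ} {D Dt : Connection d N} {f : M → N} {x : M}
  {ξM : Π x : M, TangentSpace (𝓡 k) x}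

lemma mem_range_alongDeriv_ξ (hD : IsLeviCivita D) (hS : IsSQSasakian S β D)
    (hDt : IsSemisymmetricMetric S.η Dt) (hf : Manifold.IsImmersion (𝓡 k) (𝓡 d) ∞ f)
    (hinv : IsInvariant k S f) (u : TangentSpace (𝓡 k) x) :
    alongDeriv Dt f (fun x' ↦ S.ξ (f x')) x u ∈ Set.range (df k d f x) := by
  obtain ⟨z, hz⟩ := (hinv x).1
  obtain ⟨w, hw⟩ := (hinv x).2 u
  exact ⟨-(β (f x) • w) + u - S.η (f x) (df k d f x u) • z, by
    rw [alongDeriv_semisymmetric_ξ hD hS hDt (hf.contMDiff.mdifferentiableAt (by simp)), ← hz, ← hw,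
      map_sub, map_add, map_neg, map_smul, map_smul]⟩

lemma df_inducedConn_ξ (hD : IsLeviCivita D) (hS : IsSQSasakian S β D)
    (hDt : IsSemisymmetricMetric S.η Dt) (hf : Manifold.IsImmersion (𝓡 k) (𝓡 d) ∞ f)
    (hinv : IsInvariant k S f) (hξ : ∀ x, df k d f x (ξM x) = S.ξ (f x))
    (X : Π x : M, TangentSpace (𝓡 k) x) (x : M) :
    df k d f x (inducedConn Dt f X ξM x) =
      -(β (f x) • S.φ (f x) (df k d f x (X x))) + df k d f x (X x) -
        S.η (f x) (df k d f x (X x)) • S.ξ (f x) := by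
  have hp : pushField f ξM = fun x' ↦ S.ξ (f x') := funext hξ
  rw [inducedConn, hp,
    df_tangentPart (df_injective hf x) (mem_range_alongDeriv_ξ hD hS hDt hf hinv _),
    alongDeriv_semisymmetric_ξ hD hS hDt (hf.contMDiff.mdifferentiableAt (by simp))]

lemma inducedConn_ξ_ξ (hD : IsLeviCivita D) (hS : IsSQSasakian S β D)
    (hDt : IsSemisymmetricMetric S.η Dt) (hf : Manifold.IsImmersion (𝓡 k) (𝓡 d) ∞ f)
    (hinv : IsInvariant k S f) (hξ : ∀ x, df k d f x (ξM x) = S.ξ (f x)) :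
    inducedConn Dt f ξM ξM = fun _ ↦ 0 := by
  refine funext fun x ↦ df_injective hf x ?_
  rw [df_inducedConn_ξ hD hS hDt hf hinv hξ, hξ, S.φ_ξ, S.η_ξ]
  simp

variable [IsManifold (𝓡 k) ∞ M]

lemma secondFundForm_semisymmetric (hD : IsLeviCivita D) (hDt : IsSemisymmetricMetric S.η Dt)
    (hf : Manifold.IsImmersion (𝓡 k) (𝓡 d) ∞ f) (hξ : S.ξ (f x) ∈ Set.range (df k d f x))
    (u v : TangentSpace (𝓡 k) x) :
    secondFundForm Dt f x u v = secondFundForm D f x u v := by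
  obtain ⟨z, hz⟩ := hξ
  rw [secondFundForm, alongDeriv_semisymmetric hD hDt, add_sub_assoc, ← hz, ← map_smul,
    ← map_smul, ← map_sub, normalPart_add_of_mem_range (df_injective hf x) _ ⟨_, rfl⟩]
  rfl

lemma secondFundForm_semisymmetric_comm (hD : IsLeviCivita D)
    (hDt : IsSemisymmetricMetric S.η Dt)
    (hf : Manifold.IsImmersion (𝓡 k) (𝓡 d) ∞ f) (hξ : S.ξ (f x) ∈ Set.range (df k d f x))
    (u v : TangentSpace (𝓡 k) x) :
    secondFundForm Dt f x u v = secondFundForm Dt f x v u := by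
  rw [secondFundForm_semisymmetric hD hDt hf hξ, secondFundForm_comm D hD.torsion_eq_zero hf,
    secondFundForm_semisymmetric hD hDt hf hξ]

lemma secondFundForm_ξ (hD : IsLeviCivita D) (hS : IsSQSasakian S β D)
    (hDt : IsSemisymmetricMetric S.η Dt) (hf : Manifold.IsImmersion (𝓡 k) (𝓡 d) ∞ f)
    (hinv : IsInvariant k S f) (hs : IsSmoothField ξM) (hξ : ∀ x, df k d f x (ξM x) = S.ξ (f x))
    (u : TangentSpace (𝓡 k) x) : secondFundForm Dt f x u (ξM x) = 0 := by
  have hp : pushField f ξM = fun x' ↦ S.ξ (f x') := funext hξ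
  rw [secondFundForm_eq Dt hf (hs.mdifferentiableAt x), hp]
  exact normalPart_eq_zero (df_injective hf x) (mem_range_alongDeriv_ξ hD hS hDt hf hinv u)

/-- The derivative in the direction `ξ` of a field tangent to an invariant submanifold. -/
lemma alongDeriv_pushField_ξ (hD : IsLeviCivita D) (hS : IsSQSasakian S β D)
    (hDt : IsSemisymmetricMetric S.η Dt) (hf : Manifold.IsImmersion (𝓡 k) (𝓡 d) ∞ f)
    (hs : IsSmoothField ξM) (hξ : ∀ x, df k d f x (ξM x) = S.ξ (f x))
    {X : Π x : M, TangentSpace (𝓡 k) x} (hX : IsSmoothField X) (x : M) :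
    alongDeriv Dt f (pushField f X) x (ξM x) =
      -(β (f x) • S.φ (f x) (df k d f x (X x))) - df k d f x (bracket X ξM x) := by
  have hp : pushField f ξM = fun x' ↦ S.ξ (f x') := funext hξ
  have h := alongDeriv_pushField_sub Dt hf.contMDiff (hX.mdifferentiableAt x)
    (hs.mdifferentiableAt x)
  rw [hp, alongDeriv_semisymmetric_ξ hD hS hDt (hf.contMDiff.mdifferentiableAt (by simp)),
    hDt.torsion_eq, hξ, S.η_ξ, one_smul] at h
  linear_combination (norm := module) (-1 : ℝ) • h

/-- `R(X, ξ) ξ = β² X + β φ X` modulo `ξ`, for the connection induced by the semisymmetric metric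
connection on an invariant submanifold. -/
lemma exists_inducedCurv_ξ_ξ [T2Space N] (hD : IsLeviCivita D) (hS : IsSQSasakian S β D)
    (hDt : IsSemisymmetricMetric S.η Dt) (hf : Manifold.IsImmersion (𝓡 k) (𝓡 d) ∞ f)
    (hinv : IsInvariant k S f)
    (hs : IsSmoothField ξM) (hξ : ∀ x, df k d f x (ξM x) = S.ξ (f x))
    {X : Π x : M, TangentSpace (𝓡 k) x} (hX : IsSmoothField X) {w : TangentSpace (𝓡 k) x}
    (hw : df k d f x w = S.φ (f x) (df k d f x (X x))) :
    ∃ c : ℝ, inducedCurv Dt f X ξM ξM x = β (f x) ^ 2 • X x + β (f x) • w + c • ξM x := by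
  have hinj := df_injective hf x
  have hfx : MDifferentiableAt (𝓡 k) (𝓡 d) f x := hf.contMDiff.mdifferentiableAt (by simp)
  have hφX : DiffAlong k f (fun x' ↦ S.φ (f x') (pushField f X x')) x :=
    (diffAlong_pushField hf.contMDiff (hX.mdifferentiableAt x)).map S.smooth_φ
  have hVX : DiffAlong k f (pushField f X) x :=
    diffAlong_pushField hf.contMDiff (hX.mdifferentiableAt x)
  have hVξ : DiffAlong k f (fun x' ↦ S.ξ (f x')) x := .comp hfx (S.smooth_ξ.mdifferentiableAt _)
  have hβ : MDifferentiableAt (𝓡 k) 𝓘(ℝ, ℝ) (fun x' ↦ -β (f x')) x :=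
    ((hS.smooth_β.mdifferentiableAt (by simp)).comp x hfx).neg
  have hηX : MDifferentiableAt (𝓡 k) 𝓘(ℝ, ℝ) (fun x' ↦ -S.η (f x') (pushField f X x')) x :=
    (hVX.mdifferentiableAt_form S.smooth_η).neg
  have hβξ : mvfderiv (𝓡 k) (fun x' ↦ -β (f x')) x (ξM x) = 0 := by
    have h1 := mvfderiv_comp_apply x ((hS.smooth_β.mdifferentiableAt (by simp)).neg) hfx (ξM x)
    rw [hξ, mvfderiv_neg] at h1
    have h2 := hS.ξ_β (f x)
    rw [dirDeriv] at h2
    rw [neg_apply, h2, neg_zero] at h1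
    exact h1
  have hE : pushField f (inducedConn Dt f X ξM) = fun x' ↦
      (-β (f x')) • S.φ (f x') (pushField f X x') + pushField f X x' +
        (-S.η (f x') (pushField f X x')) • S.ξ (f x') := by
    funext x'
    rw [pushField, df_inducedConn_ξ hD hS hDt hf hinv hξ, pushField, neg_smul, neg_smul,
      sub_eq_add_neg]
  -- `p` represents the derivative of `X` in the direction `ξ`, which is already tangential.
  set p := -(β (f x) • w) - bracket X ξM x with hp
  have hP : alongDeriv Dt f (pushField f X) x (ξM x) = df k d f x p := by
    rw [alongDeriv_pushField_ξ hD hS hDt hf hs hξ hX, hp, map_sub, map_neg, map_smul, hw]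
  have hφ := alongDeriv_map_of_parallel (V := pushField f X) (v := ξM x) Dt S.smooth_φ
    (fun W hW ↦ by rw [hξ]; exact semisymmetric_apply_φ_ξ hD hS hDt hW _) hVX
  have hξξ : alongDeriv Dt f (fun x' ↦ S.ξ (f x')) x (ξM x) = 0 := by
    rw [alongDeriv_semisymmetric_ξ hD hS hDt hfx, hξ, S.φ_ξ, S.η_ξ]
    simp
  -- Differentiation of `-βφX + X - η(X)ξ` along `ξ`: `β` is constant, `φ` is parallel and `ξ` has
  -- zero derivative in that direction. Only the derivative `c` of `-η(X)` is left uncomputed, and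
  -- it merely multiplies `ξ`.
  have hDE := alongDeriv_add Dt ((hφX.smul hβ).add hVX) (hVξ.smul hηX) (ξM x)
  rw [alongDeriv_add Dt (hφX.smul hβ) hVX, alongDeriv_smul Dt hβ hφX, alongDeriv_smul Dt hηX hVξ,
    hξξ, hβξ, hφ, hP, ← hE] at hDE
  generalize mvfderiv (𝓡 k) (fun x' ↦ -S.η (f x') (pushField f X x')) x (ξM x) = c at hDE
  obtain ⟨q, hq⟩ := (hinv x).2 p
  have h2 : inducedConn Dt f ξM (inducedConn Dt f X ξM) x = -β (f x) • q + p + c • ξM x := by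
    rw [inducedConn, hDE, ← tangentPart_df hinj (-β (f x) • q + p + c • ξM x)]
    congr 1
    simp only [map_add, map_smul, hq, hξ]
    module
  have h1 : inducedConn Dt f X (fun _ ↦ 0) x = 0 := by
    have h0 : pushField f (fun x' ↦ (0 : TangentSpace (𝓡 k) x')) =
        fun x' ↦ (0 : TangentSpace (𝓡 d) (f x')) := funext fun x' ↦ map_zero _
    rw [inducedConn, h0, alongDeriv_zero Dt hfx, ← map_zero (df k d f x), tangentPart_df hinj]
  -- The `ξ`-terms come from `φ²X`, from the derivative of `-η(X)`, and from the derivative of `ξ`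
  -- along `[X, ξ]`.
  refine ⟨-(β (f x) ^ 2 * S.η (f x) (df k d f x (X x))) - c +
    S.η (f x) (df k d f x (bracket X ξM x)), hinj ?_⟩
  rw [inducedCurv, inducedConn_ξ_ξ hD hS hDt hf hinv hξ, h1, h2, zero_sub, map_sub,
    df_inducedConn_ξ hD hS hDt hf hinv hξ, map_neg]
  simp only [map_add, map_smul, hq, hξ, hp, map_sub, map_neg, hw, S.φ_φ]
  module

/-- The pseudo-parallelity condition, evaluated on `(X, ξ; Z, ξ)`. -/
lemma curvActionSecondFundForm_ξ_ξ [T2Space N] (hD : IsLeviCivita D) (hS : IsSQSasakian S β D)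
    (hDt : IsSemisymmetricMetric S.η Dt) (hf : Manifold.IsImmersion (𝓡 k) (𝓡 d) ∞ f)
    (hinv : IsInvariant k S f)
    (hs : IsSmoothField ξM) (hξ : ∀ x, df k d f x (ξM x) = S.ξ (f x))
    {X Z : Π x : M, TangentSpace (𝓡 k) x} (hX : IsSmoothField X) {w : TangentSpace (𝓡 k) x}
    (hw : df k d f x w = S.φ (f x) (df k d f x (X x))) :
    curvActionSecondFundForm Dt f X ξM Z ξM x =
      -(β (f x) ^ 2 • secondFundForm Dt f x (Z x) (X x) +
        β (f x) • secondFundForm Dt f x (Z x) w) := by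
  obtain ⟨c, hc⟩ := exists_inducedCurv_ξ_ξ hD hS hDt hf hinv hs hξ hX hw
  -- Needed at all points, not only at `x`: the normal curvature differentiates the field `h(Z, ξ)`.
  have h0 (x' : M) (u : TangentSpace (𝓡 k) x') : secondFundForm Dt f x' u (ξM x') = 0 :=
    secondFundForm_ξ hD hS hDt hf hinv hs hξ u
  rw [curvActionSecondFundForm, h0, hc, secondFundForm_add_right Dt hf,
    secondFundForm_add_right Dt hf, secondFundForm_smul_right Dt hf,
    secondFundForm_smul_right Dt hf, secondFundForm_smul_right Dt hf, h0]
  simp only [h0, normalCurv, normalConn_zero hf]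
  simp

lemma tachibana_ξ_ξ (hD : IsLeviCivita D) (hS : IsSQSasakian S β D)
    (hDt : IsSemisymmetricMetric S.η Dt) (hf : Manifold.IsImmersion (𝓡 k) (𝓡 d) ∞ f)
    (hinv : IsInvariant k S f)
    (hs : IsSmoothField ξM) (hξ : ∀ x, df k d f x (ξM x) = S.ξ (f x))
    (X Z : Π x : M, TangentSpace (𝓡 k) x) :
    tachibana Dt f X ξM Z ξM x = secondFundForm Dt f x (Z x) (X x) := by
  have h0 (u : TangentSpace (𝓡 k) x) : secondFundForm Dt f x u (ξM x) = 0 :=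
    secondFundForm_ξ hD hS hDt hf hinv hs hξ u
  have hcomm := secondFundForm_semisymmetric_comm (x := x) hD hDt hf (hinv x).1
  have h1 : inducedMetric d f (ξM x) (ξM x) = 1 := by
    rw [inducedMetric, hξ, S.metric_ξ, S.η_ξ]
  rw [tachibana, h0, h0, hcomm (ξM x), h0, h1, hcomm (X x)]
  simp

/-- An invariant submanifold that is pseudo-parallel at `x` is totally geodesic at `x`. -/
lemma secondFundForm_eq_zero_of_pseudoParallel [T2Space N] [T2Space M] (hD : IsLeviCivita D)
    (hS : IsSQSasakian S β D) (hDt : IsSemisymmetricMetric S.η Dt)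
    (hf : Manifold.IsImmersion (𝓡 k) (𝓡 d) ∞ f) (hinv : IsInvariant k S f)
    (hs : IsSmoothField ξM) (hξ : ∀ x, df k d f x (ξM x) = S.ξ (f x)) {L : ℝ}
    (hL : (L + β (f x) ^ 2) ^ 2 + β (f x) ^ 2 ≠ 0)
    (hpar : ∀ X Y Z U : Π x : M, TangentSpace (𝓡 k) x,
      IsSmoothField X → IsSmoothField Y → IsSmoothField Z → IsSmoothField U →
      curvActionSecondFundForm Dt f X Y Z U x = L • tachibana Dt f X Y Z U x)
    (u v : TangentSpace (𝓡 k) x) : secondFundForm Dt f x u v = 0 := by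
  have key (v w : TangentSpace (𝓡 k) x) (hw : df k d f x w = S.φ (f x) (df k d f x v)) :
      (L + β (f x) ^ 2) • secondFundForm Dt f x u v + β (f x) • secondFundForm Dt f x u w = 0 := by
    obtain ⟨X, hX, rfl⟩ := exists_isSmoothField_eq x v
    obtain ⟨Z, hZ, rfl⟩ := exists_isSmoothField_eq x u
    have h := hpar X ξM Z ξM hX hs hZ hs
    rw [curvActionSecondFundForm_ξ_ξ hD hS hDt hf hinv hs hξ hX hw,
      tachibana_ξ_ξ hD hS hDt hf hinv hs hξ] at h
    linear_combination (norm := module) (-1 : ℝ) • h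
  obtain ⟨w, hw⟩ := (hinv x).2 v
  have h1 := key v w hw
  -- The same relation for `φv`, with `φ²v = -v + η(v)ξ`.
  have h2 := key w (-v + S.η (f x) (df k d f x v) • ξM x) (by
    rw [hw, S.φ_φ, map_add, map_neg, map_smul, hξ])
  rw [secondFundForm_add_right Dt hf, secondFundForm_smul_right Dt hf,
    secondFundForm_ξ hD hS hDt hf hinv hs hξ, smul_zero, add_zero, ← neg_one_smul ℝ v,
    secondFundForm_smul_right Dt hf] at h2
  -- Elimination of `h(u, φv)` leaves the determinant of the system as coefficient.
  have h3 : ((L + β (f x) ^ 2) ^ 2 + β (f x) ^ 2) • secondFundForm Dt f x u v = 0 := by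
    linear_combination (norm := module) (L + β (f x) ^ 2) • h1 - β (f x) • h2
  exact (smul_eq_zero.1 h3).resolve_left hL

lemma isTotallyGeodesic_of_pseudoParallel [T2Space N] [T2Space M] (hD : IsLeviCivita D)
    (hS : IsSQSasakian S β D) (hDt : IsSemisymmetricMetric S.η Dt)
    (hf : Manifold.IsImmersion (𝓡 k) (𝓡 d) ∞ f) (hinv : IsInvariant k S f)
    {L : nonUmbilicalSet k D f → ℝ}
    (hL : ∀ x : nonUmbilicalSet k D f, (L x + β (f x) ^ 2) ^ 2 + β (f x) ^ 2 ≠ 0)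
    (hpar : IsDeszczPseudoParallel k Dt f (nonUmbilicalSet k D f) L) :
    IsTotallyGeodesic k D f := by
  choose ξM hξ using fun x ↦ (hinv x).1
  have hs : IsSmoothField ξM := isSmoothField_of_pushField hf S.smooth_ξ hξ
  have heq (x : M) := secondFundForm_semisymmetric (k := k) (x := x) hD hDt hf (hinv x).1
  -- At a point of `W` the condition forces `h = 0`, hence `H = 0`, so the point is not in `W`.
  have hempty (x : M) : x ∉ nonUmbilicalSet k D f := by
    intro hx
    have h0 (u v : TangentSpace (𝓡 k) x) : secondFundForm D f x u v = 0 := by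
      rw [← heq]
      exact secondFundForm_eq_zero_of_pseudoParallel hD hS hDt hf hinv hs hξ (hL ⟨x, hx⟩)
        (fun X Y Z U hX hY hZ hU ↦ hpar X Y Z U hX hY hZ hU ⟨x, hx⟩) u v
    obtain ⟨u, v, huv⟩ := hx
    refine huv ?_
    simp [meanCurvature, h0]
  intro x u v
  have humb (u v : TangentSpace (𝓡 k) x) :
      secondFundForm D f x u v = inducedMetric d f u v • meanCurvature k D f x := by
    by_contra h
    exact hempty x ⟨u, v, sub_ne_zero.2 h⟩
  -- With `g(ξ,ξ) = 1` and `h(ξ,ξ) = 0`, umbilicity yields `H = 0`.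
  have hξξ := humb (ξM x) (ξM x)
  rw [← heq, secondFundForm_ξ hD hS hDt hf hinv hs hξ, inducedMetric, hξ, S.metric_ξ, S.η_ξ,
    one_smul] at hξξ
  rw [humb, ← hξξ, smul_zero]

end Submanifold

end SQSasakian

end

open SQSasakian in
theorem theorem3p6 {m n : ℕ} (hmn : m < n)
    {N : Type*} [TopologicalSpace N] [T2Space N] [ChartedSpace (Model (2 * n + 1)) N]
    [IsManifold (𝓡 (2 * n + 1)) ∞ N]
    [RiemannianBundle (fun y : N ↦ TangentSpace (𝓡 (2 * n + 1)) y)]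
    [IsContMDiffRiemannianBundle (𝓡 (2 * n + 1)) ∞ (Model (2 * n + 1))
      (fun y : N ↦ TangentSpace (𝓡 (2 * n + 1)) y)]
    (S : AlmostContactMetric (2 * n + 1) N) (β : N → ℝ)
    (D Dt : Connection (2 * n + 1) N) (hD : IsLeviCivita D) (hS : IsSQSasakian S β D)
    (hDt : IsSemisymmetricMetric S.η Dt)
    {M : Type*} [TopologicalSpace M] [T2Space M] [ChartedSpace (Model (2 * m + 1)) M]
    [IsManifold (𝓡 (2 * m + 1)) ∞ M]
    (f : M → N) (hf : Manifold.IsImmersion (𝓡 (2 * m + 1)) (𝓡 (2 * n + 1)) ∞ f)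
    (hinv : IsInvariant (2 * m + 1) S f) :
    (∀ L : nonUmbilicalSet (2 * m + 1) D f → ℝ,
      (∀ x : nonUmbilicalSet (2 * m + 1) D f, (L x + β (f x) ^ 2) ^ 2 + β (f x) ^ 2 ≠ 0) →
        (IsTotallyGeodesic (2 * m + 1) D f ↔ IsDeszczPseudoParallel (2 * m + 1) Dt f (nonUmbilicalSet (2 * m + 1) D f) L)) ∧
    (IsTotallyGeodesic (2 * m + 1) D f ↔ ∃ L : nonUmbilicalSet (2 * m + 1) D f → ℝ,
      (∀ x : nonUmbilicalSet (2 * m + 1) D f, (L x + β (f x) ^ 2) ^ 2 + β (f x) ^ 2 ≠ 0) ∧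
        IsDeszczPseudoParallel (2 * m + 1) Dt f (nonUmbilicalSet (2 * m + 1) D f) L) := by
  have hpp : IsTotallyGeodesic (2 * m + 1) D f → ∀ L,
      IsDeszczPseudoParallel (2 * m + 1) Dt f (nonUmbilicalSet (2 * m + 1) D f) L := fun h L ↦
    isDeszczPseudoParallel_of_secondFundForm_eq_zero hf (fun x u v ↦ by
      rw [secondFundForm_semisymmetric hD hDt hf (hinv x).1, h x u v]) _ L
  refine ⟨fun L hL ↦ ⟨fun h ↦ hpp h L, isTotallyGeodesic_of_pseudoParallel hD hS hDt hf hinv hL⟩,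
    -- Any admissible function serves; this one gives `L + β² = 1`, so the quantity to be nonzero is
    -- `1 + β²`.
    fun h ↦ ⟨fun x ↦ 1 - β (f x) ^ 2, fun x ↦ ?_, hpp h _⟩, fun ⟨_, hL, h⟩ ↦
    isTotallyGeodesic_of_pseudoParallel hD hS hDt hf hinv hL h⟩
  rw [sub_add_cancel]
  positivity
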